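/- **Setting.** An LLL instance consists of independent random variables $(X_x)_{x}$ (a finite or countably infinite family, taking values in a standard Borel space $\Omega$, with arbitrary laws) and $n$ bad events, each of which depends on its own set of variables. The dependency graph has the events as nodes, two distinct events being adjacent if they share a variable. Each event is adjacent to at most $d$ others and has probability at most $p$, and the nodes carry distinct identifiers in $\{1,\dots,n^{\kappa}\}$. Probing a node (by its identifier) reveals its event, the variables on which the event depends and their laws, and the identifiers of its neighbours. When a node is queried, the algorithm, which keeps no state between queries, adaptively probes nodes and then outputs values for the dependent variables of the queried node. In the LCA model the algorithm may probe any identifier and has access to a shared infinite string of independent random bits. In the VOLUME model only the queried node and neighbours of already probed nodes may be probed, and each node has its own independent infinite string of random bits, which is revealed when the node is probed. A (randomized) algorithm succeeds on an instance if its answers to the queries of all nodes are restrictions of one common assignment of the variables, and this assignment avoids all bad events. **Theorem.** For all constants $\varepsilon>0$, $c>0$ and $\kappa\in\mathbb N$ there are constants $C$ and $d_0$ such that the following holds for all $n$, all $d\ge d_0$, all $p$ with $0<p\le d^{-(10+\varepsilon)}$, and every (nonempty) $\Omega$. There are an LCA algorithm and a VOLUME algorithm (depending only on $\varepsilon,c,\kappa,n,d,p,\Omega$)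 each of which, on every LLL instance with these parameters, always makes at most $$d^{\,C\cdot\max\{1,\ \log\log_{1/p} n\}}$$ probes per query (the $\log\log$ being read as $0$ when $n\le 1$), and succeeds with probability at least $1-n^{-c}$. In particular, if $d=d(n)\to\infty$ and $p=d^{-(10+\Omega(1))}$, the LLL can be solved with high probability in the LCA and VOLUME models with $d^{O(\log\log_{1/p} n)}$ probes per query. -/

import Mathlib

open MeasureTheory

/-- An instance of the Lovász Local Lemma with `n` bad events, viewed as a distributed input.
Variables are named by natural numbers, are mutually independent, and take values in `Ω`; events
are indexed by `Fin n` and carry distinct identifiers. Event `v` depends on the variables in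
`vbl v` only: it is a set of assignments of these variables. -/
structure LLLInstance (Ω : Type*) [MeasurableSpace Ω] (n : ℕ) where
  /-- the distribution of each variable -/
  law : ℕ → ProbabilityMeasure Ω
  /-- the variables on which an event depends -/
  vbl : Fin n → Set ℕ
  /-- the assignments of the dependent variables for which the bad event happens -/
  bad : ∀ v : Fin n, Set (vbl v → Ω)
  measurableSet_bad : ∀ v, MeasurableSet (bad v)
  /-- the unique identifiers of the events -/
  id : Fin n → ℕ
  id_injective : Function.Injective id

/-- What a probe of a node reveals of the input: the variables of the event, their distributions,
the event itself, and the identifiers of the neighbours in the dependency graph. -/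
structure NodeInfo (Ω : Type*) [MeasurableSpace Ω] where
  vars : Set ℕ
  law : vars → ProbabilityMeasure Ω
  bad : Set (vars → Ω)
  nbrs : Set ℕ

namespace LLLInstance

variable {Ω : Type*} [MeasurableSpace Ω] {n : ℕ} (I : LLLInstance Ω n)

/-- The dependency graph: distinct events are adjacent when they share a variable. -/
def depGraph : SimpleGraph (Fin n) where
  Adj u v := u ≠ v ∧ (I.vbl u ∩ I.vbl v).Nonempty
  symm := ⟨fun _ _ h => ⟨h.1.symm, by rw [Set.inter_comm]; exact h.2⟩⟩
  loopless := ⟨fun _ h => h.1 rfl⟩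

/-- The probability of the bad event `v` when the variables are sampled independently. -/
noncomputable def prob (v : Fin n) : ENNReal :=
  Measure.infinitePi (fun x : I.vbl v => (I.law x : Measure Ω)) (I.bad v)

/-- Every event shares variables with at most `d` others and has probability at most `p`, and the
identifiers lie in `{1, …, n ^ κ}`. -/
def HasParams (κ d : ℕ) (p : ℝ) : Prop :=
  (∀ v, I.id v ∈ Finset.Icc 1 (n ^ κ)) ∧
    (∀ v, (I.depGraph.neighborSet v).ncard ≤ d) ∧
    ∀ v, I.prob v ≤ ENNReal.ofReal p

/-- The part of the input that belongs to node `v`. -/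
def info (v : Fin n) : NodeInfo Ω where
  vars := I.vbl v
  law := fun x => I.law x
  bad := I.bad v
  nbrs := I.id '' I.depGraph.neighborSet v

open Classical in
/-- The oracle that answers a probe of identifier `i` by the data `f v` of the node `v` with this
identifier, and by `none` if there is no such node. -/
noncomputable def oracle {α : Type*} (f : Fin n → α) (i : ℕ) : Option α :=
  if h : ∃ v, I.id v = i then some (f h.choose) else none

/-- The answers `out v` to the queries of all nodes `v` (where `out v x` is the value that is
reported at `v` for the variable `x`, and only the dependent variables of `v` matter) are the
restrictions of a single assignment, and this assignment avoids all bad events. -/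
def IsSolution (out : Fin n → ℕ → Ω) : Prop :=
  ∃ σ : ℕ → Ω, (∀ v, ∀ x ∈ I.vbl v, out v x = σ x) ∧
    ∀ v, (fun x : I.vbl v => σ x) ∉ I.bad v

end LLLInstance

/-- An adaptive probing procedure: it stops with an output, or probes an identifier and continues
depending on the answer. -/
inductive ProbeTree (α : Type*) (β : Type*) where
  | output (b : β) : ProbeTree α β
  | probe (i : ℕ) (next : Option α → ProbeTree α β) : ProbeTree α β

namespace ProbeTree

variable {α β : Type*}

/-- The output of the procedure when probes are answered by `ans`. -/
def run (ans : ℕ → Option α) : ProbeTree α β → β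
  | output b => b
  | probe i next => run ans (next (ans i))

/-- The number of probes that the procedure makes when probes are answered by `ans`. -/
def numProbes (ans : ℕ → Option α) : ProbeTree α β → ℕ
  | output _ => 0
  | probe i next => numProbes ans (next (ans i)) + 1

/-- Every probe of the procedure, when probes are answered by `ans`, is of an identifier in `S` or
of a neighbour (as given by `nbrs`) of a node probed earlier. -/
def Connected (ans : ℕ → Option α) (nbrs : α → Set ℕ) : Set ℕ → ProbeTree α β → Prop
  | _, output _ => True
  | S, probe i next =>
      i ∈ S ∧ Connected ans nbrs (S ∪ {j | ∃ a, ans i = some a ∧ j ∈ nbrs a}) (next (ans i))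

end ProbeTree

/-- An infinite sequence of independent fair random bits. -/
noncomputable def randomBits : Measure (ℕ → Bool) :=
  Measure.infinitePi (fun _ : ℕ => (PMF.uniformOfFintype Bool).toMeasure)

/-- A randomized LCA algorithm: from the shared random string and the identifier of the queried
node, an adaptive procedure that may probe arbitrary identifiers. It keeps no state between
queries. -/
def LCAAlgorithm (Ω : Type*) [MeasurableSpace Ω] :=
  (ℕ → Bool) → ℕ → ProbeTree (NodeInfo Ω) (ℕ → Ω)

/-- A VOLUME algorithm: from the identifier of the queried node, an adaptive procedure; a probe of
a node reveals its input together with its private random bits. -/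
def VolumeAlgorithm (Ω : Type*) [MeasurableSpace Ω] :=
  ℕ → ProbeTree (NodeInfo Ω × (ℕ → Bool)) (ℕ → Ω)

/-- On the instance `I`, the LCA algorithm always makes at most `q` probes per query, and except
with probability at most `δ` its answers to the queries of all nodes form a solution. -/
def LCAAlgorithm.Solves {Ω : Type*} [MeasurableSpace Ω] {n : ℕ} (A : LCAAlgorithm Ω)
    (I : LLLInstance Ω n) (q δ : ℝ) : Prop :=
  (∀ (r : ℕ → Bool) (v : Fin n),
    (((A r (I.id v)).numProbes (I.oracle I.info) : ℕ) : ℝ) ≤ q) ∧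
  randomBits {r | ¬ I.IsSolution (fun v => (A r (I.id v)).run (I.oracle I.info))}
    ≤ ENNReal.ofReal δ

/-- The oracle of the VOLUME model when node `v` holds the private random bits `r v`. -/
noncomputable def LLLInstance.volumeOracle {Ω : Type*} [MeasurableSpace Ω] {n : ℕ}
    (I : LLLInstance Ω n) (r : Fin n → ℕ → Bool) : ℕ → Option (NodeInfo Ω × (ℕ → Bool)) :=
  I.oracle (fun v => (I.info v, r v))

/-- On the instance `I`, the VOLUME algorithm always makes at most `q` probes per query, the probed
region always grows connectedly from the queried node, and except with probability at most `δ` over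
the independent random bits of the nodes its answers to the queries of all nodes form a solution. -/
def VolumeAlgorithm.Solves {Ω : Type*} [MeasurableSpace Ω] {n : ℕ} (A : VolumeAlgorithm Ω)
    (I : LLLInstance Ω n) (q δ : ℝ) : Prop :=
  (∀ (r : Fin n → ℕ → Bool) (v : Fin n),
    (((A (I.id v)).numProbes (I.volumeOracle r) : ℕ) : ℝ) ≤ q ∧
    (A (I.id v)).Connected (I.volumeOracle r) (fun a => a.1.nbrs) {I.id v}) ∧
  Measure.pi (fun _ : Fin n => randomBits)
      {r | ¬ I.IsSolution (fun v => (A (I.id v)).run (I.volumeOracle r))}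
    ≤ ENNReal.ofReal δ

/-- The probe bound `d ^ (C * max 1 (log log_{1/p} n))`. -/
noncomputable def probeBound (C : ℝ) (n d : ℕ) (p : ℝ) : ℝ :=
  (d : ℝ) ^ (C * max 1 (Real.log (Real.logb (1 / p) n)))

/-! ### Sampling arbitrary laws from fair bits -/

open ProbabilityTheory Filter Topology

/-! The algorithm simulates parallel Moser–Tardos resampling. Every variable has an infinite list of
independent samples, made from the private bits of the node of smallest identifier that depends on
it. In each round the bad nodes without bad neighbours of smaller identifier move their variables on
to the next samples.

A resampling has a causal past: earlier resamplings reached by chains of steps of length at most 2.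
Sorted by longest chain, the past falls into layers of variable-disjoint nodes, and the counters of
its variables can be read off from the deeper layers (`counts_eq_cnt`). Distinct members are
therefore tested on disjoint sets of samples, and given layers with `S` tested nodes are consistent
with probability at most `p ^ S`. If at least half of the nodes are tested, a generating function
for layer sequences bounds the probability of any evidence with `S` tested nodes by `4 * A ^ S`,
where `A = 64 * (d + 1) ^ 4 * p` (`measure_evidence_le`).

A node that is still bad after `K` rounds, with `K` of order `log_{1/p} n`, gives evidence with `K`
tested nodes, which is unlikely. To make the process local, let `τ = ⌈log₂ K⌉`. The first `4τ`
rounds depend only on balls of radius `O(τ)`. For a later resampling, consider its past inside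
growing balls. Doubling at `τ` successive radii would give `2 ^ τ ≥ K` members, so again large
evidence. At a radius without doubling, at least half of the past lies in the interior, where the
counters are fully visible; this gives evidence with `4τ` tested nodes within distance `10τ`
(`evidence_of_late`).

Late resampling thus happens only at nodes with such local evidence, the suspects. Far apart
suspects are independent, and `p ≤ d ^ (-10)` outweighs the roughly `d ^ (20τ)` ways to continue a
cluster, so clusters of suspects are small (`measure_large_cluster_le`). Different clusters do not
interact. A query explores the cluster of its node with a margin of `10τ + 4`, using `d ^ O(τ)`
probes, and replays the process there (`run_resamplingAlgorithm`). The LCA algorithm cuts its shared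
string into private ones. -/

instance isProbabilityMeasure_randomBits : IsProbabilityMeasure randomBits := by
  unfold randomBits; infer_instance

/-- The real number in `[0, 1]` with the given binary expansion. -/
noncomputable def binaryReal (b : ℕ → Bool) : ℝ :=
  Real.ofDigits (b := 2) fun i => bif b i then 1 else 0

lemma binaryReal_mem (b : ℕ → Bool) : binaryReal b ∈ Set.Icc (0 : ℝ) 1 :=
  ⟨Real.ofDigits_nonneg _, Real.ofDigits_le_one _⟩

lemma binaryReal_eq (b : ℕ → Bool) :
    binaryReal b = ((bif b 0 then 1 else 0) + binaryReal (fun i => b (i + 1))) / 2 := by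
  unfold binaryReal
  rw [Real.ofDigits_eq_sum_add_ofDigits _ 1]
  cases h : b 0 <;> simp [Real.ofDigitsTerm, h] <;> ring

lemma measurable_binaryReal : Measurable binaryReal := by
  have : Continuous binaryReal := by
    unfold binaryReal Real.ofDigits
    refine continuous_tsum (u := fun n => (1 / 2 : ℝ) ^ n) (fun i => ?_)
      (summable_geometric_of_lt_one (by norm_num) (by norm_num)) (fun n b => ?_)
    · have h : Continuous fun c : Bool => (((bif c then 1 else 0 : Fin 2) : ℕ) : ℝ) :=
        continuous_of_discreteTopology
      exact (h.comp (continuous_apply i)).mul continuous_const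
    · rw [Real.norm_of_nonneg Real.ofDigitsTerm_nonneg]
      refine Real.ofDigitsTerm_le.trans ?_
      simp only [one_div, inv_pow, pow_succ]
      norm_num
  exact this.measurable

/-- The coordinates are independent and identically distributed, so the first bit is independent of
the shifted sequence, and the shift preserves the law. -/
lemma randomBits_head_tail (s : Set Bool) {A : Set (ℕ → Bool)} (hA : MeasurableSet A) :
    randomBits {b | b 0 ∈ s ∧ (fun i => b (i + 1)) ∈ A} =
      (PMF.uniformOfFintype Bool).toMeasure s * randomBits A := by
  have hind : iIndepFun (fun (i : ℕ) (b : ℕ → Bool) => b i) randomBits :=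
    iIndepFun_infinitePi (X := fun _ x => x) (fun _ => measurable_id)
  have h := indep_iSup_of_disjoint (m := fun i : ℕ =>
      MeasurableSpace.comap (fun b : ℕ → Bool => b i) inferInstance) (μ := randomBits)
    (fun i => (measurable_pi_apply i).comap_le) hind
    (S := {0}) (T := {i | i ≠ 0}) (by simp)
  have h0 : MeasurableSet[⨆ i ∈ ({0} : Set ℕ),
      MeasurableSpace.comap (fun b : ℕ → Bool => b i) inferInstance] {b : ℕ → Bool | b 0 ∈ s} := by
    rw [iSup_singleton]
    exact ⟨s, MeasurableSet.of_discrete, rfl⟩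
  have h1 : MeasurableSet[⨆ i ∈ {i : ℕ | i ≠ 0},
      MeasurableSpace.comap (fun b : ℕ → Bool => b i) inferInstance]
      ((fun (b : ℕ → Bool) i => b (i + 1)) ⁻¹' A) := by
    have hm : @Measurable _ _ (⨆ i ∈ {i : ℕ | i ≠ 0},
        MeasurableSpace.comap (fun b : ℕ → Bool => b i) inferInstance) _
        (fun (b : ℕ → Bool) i => b (i + 1)) := by
      refine @measurable_pi_lambda _ _ _ (_) _ _ fun i => ?_
      refine Measurable.mono (comap_measurable (fun b : ℕ → Bool => b (i + 1))) ?_ le_rfl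
      exact le_iSup₂_of_le (i + 1) (by simp) le_rfl
    exact hm hA
  have := (Indep_iff _ _ _).1 h _ _ h0 h1
  rw [show {b : ℕ → Bool | b 0 ∈ s ∧ (fun i => b (i + 1)) ∈ A} =
    {b : ℕ → Bool | b 0 ∈ s} ∩ ((fun (b : ℕ → Bool) i => b (i + 1)) ⁻¹' A) from rfl, this]
  congr 1
  · have := Measure.infinitePi_map_eval (fun _ : ℕ => (PMF.uniformOfFintype Bool).toMeasure) 0
    conv_rhs => rw [← this]
    rw [Measure.map_apply (measurable_pi_apply 0) MeasurableSet.of_discrete]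
    rfl
  · have := Measure.map_infinitePi_infinitePi_of_inj
      (P := fun _ : ℕ => (PMF.uniformOfFintype Bool).toMeasure) (Nat.succ_injective)
    have h2 : randomBits.map (fun (b : ℕ → Bool) i => b (i + 1)) = randomBits := this
    conv_rhs => rw [← h2]
    rw [Measure.map_apply (by fun_prop) hA]

lemma uniform_bool_singleton (c : Bool) :
    (PMF.uniformOfFintype Bool).toMeasure {c} = 2⁻¹ := by
  rw [PMF.toMeasure_apply_singleton _ _ (MeasurableSet.of_discrete)]
  simp

lemma real_binaryReal_le (a : ℝ) :
    randomBits.real {b | binaryReal b ≤ a} =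
      (randomBits.real {b | binaryReal b ≤ 2 * a} +
        randomBits.real {b | binaryReal b ≤ 2 * a - 1}) / 2 := by
  have hm : ∀ a, MeasurableSet {b | binaryReal b ≤ a} := fun a =>
    measurable_binaryReal measurableSet_Iic
  have hsplit : {b | binaryReal b ≤ a} =
      {b | b 0 ∈ ({false} : Set Bool) ∧ (fun i => b (i + 1)) ∈ {b | binaryReal b ≤ 2 * a}} ∪
      {b | b 0 ∈ ({true} : Set Bool) ∧
        (fun i => b (i + 1)) ∈ {b | binaryReal b ≤ 2 * a - 1}} := by
    ext b
    simp only [Set.mem_ofPred_eq, Set.mem_union, Set.mem_singleton_iff]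
    rw [binaryReal_eq]
    cases h : b 0 <;> simp [div_le_iff₀] <;> constructor <;> intro h <;> linarith
  rw [hsplit, measureReal_union]
  · simp only [measureReal_def]
    rw [randomBits_head_tail _ (hm _), randomBits_head_tail _ (hm _), uniform_bool_singleton,
      uniform_bool_singleton, ENNReal.toReal_mul, ENNReal.toReal_mul]
    simp
    ring
  · rw [Set.disjoint_left]
    rintro b ⟨h1, -⟩ ⟨h2, -⟩
    simp_all
  · refine MeasurableSet.inter ?_ ?_
    · exact (measurable_pi_apply 0) (MeasurableSet.of_discrete (s := ({true} : Set Bool)))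
    · have : Measurable (fun (b : ℕ → Bool) i => b (i + 1)) := by fun_prop
      exact this (hm _)

/-- Splitting by the first bit gives `F a = (F (2a) + F (2a - 1)) / 2`, which the uniform
distribution function satisfies too. For `a` in `[0, 1)` one of the two arguments lies where both
functions are trivially equal, so the maximal error is halved at each step. -/
lemma binaryReal_cdf (a : ℝ) : randomBits.real {b | binaryReal b ≤ a} = max 0 (min a 1) := by
  have hneg : ∀ a < 0, randomBits.real {b | binaryReal b ≤ a} = 0 := by
    intro a ha
    have : {b | binaryReal b ≤ a} = ∅ := by
      ext b; simp; exact ha.trans_le (binaryReal_mem b).1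
    simp [this]
  have hone : ∀ a, 1 ≤ a → randomBits.real {b | binaryReal b ≤ a} = 1 := by
    intro a ha
    have : {b | binaryReal b ≤ a} = Set.univ := by
      ext b; simp; exact (binaryReal_mem b).2.trans ha
    simp [this]
  have key : ∀ (n : ℕ) (a : ℝ),
      |randomBits.real {b | binaryReal b ≤ a} - max 0 (min a 1)| ≤ (1 / 2) ^ n := by
    intro n
    induction n with
    | zero =>
      intro a
      have h1 : randomBits.real {b | binaryReal b ≤ a} ≤ 1 := measureReal_le_one
      have h2 : 0 ≤ randomBits.real {b | binaryReal b ≤ a} := measureReal_nonneg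
      have h3 : max 0 (min a 1) ≤ 1 := max_le zero_le_one (min_le_right _ _)
      have h4 : 0 ≤ max 0 (min a 1) := le_max_left _ _
      rw [abs_le]; constructor <;> simp <;> linarith
    | succ n ih =>
      intro a
      rcases lt_or_ge a 0 with h0 | h0
      · rw [hneg a h0, min_eq_left (by linarith), max_eq_left h0.le]; simp
      rcases le_or_gt 1 a with h1 | h1
      · rw [hone a h1, min_eq_right h1]; simp
      rw [real_binaryReal_le, min_eq_left h1.le, max_eq_right h0, pow_succ]
      rcases lt_or_ge (2 * a) 1 with h | h
      · have := ih (2 * a)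
        rw [min_eq_left h.le, max_eq_right (by linarith)] at this
        rw [hneg (2 * a - 1) (by linarith)]
        rw [abs_le] at this ⊢
        constructor <;> linarith
      · have := ih (2 * a - 1)
        rw [min_eq_left (by linarith), max_eq_right (by linarith)] at this
        rw [hone (2 * a) h]
        rw [abs_le] at this ⊢
        constructor <;> linarith
  have hlim : Tendsto (fun n : ℕ => (1 / 2 : ℝ) ^ n) atTop (𝓝 0) :=
    tendsto_pow_atTop_nhds_zero_of_lt_one (by norm_num) (by norm_num)
  have := ge_of_tendsto' hlim (fun n => key n a)
  exact sub_eq_zero.mp (abs_nonpos_iff.mp this)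

/-- The point of the unit interval with the given binary expansion. -/
noncomputable def binaryUnit (b : ℕ → Bool) : unitInterval := ⟨binaryReal b, binaryReal_mem b⟩

lemma measurable_binaryUnit : Measurable binaryUnit :=
  measurable_binaryReal.subtype_mk

lemma map_binaryUnit : randomBits.map binaryUnit = volume := by
  have := Measure.isProbabilityMeasure_map (μ := randomBits) measurable_binaryUnit.aemeasurable
  refine Measure.ext_of_Iic _ _ fun x => ?_
  rw [unitInterval.volume_Iic, Measure.map_apply measurable_binaryUnit measurableSet_Iic]
  have h : binaryUnit ⁻¹' Set.Iic x = {b | binaryReal b ≤ x} := rfl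
  rw [h, ← ofReal_measureReal, binaryReal_cdf, min_eq_left x.2.2, max_eq_right x.2.1]

/-- Binary digits make a uniform point of the unit interval, and every law on a standard Borel space
is an image of the uniform law. -/
lemma exists_measurable_map_randomBits_eq {Ω : Type*} [MeasurableSpace Ω] [StandardBorelSpace Ω]
    [Nonempty Ω] (μ : ProbabilityMeasure Ω) :
    ∃ f : (ℕ → Bool) → Ω, Measurable f ∧ randomBits.map f = μ := by
  obtain ⟨g, hg, hmap⟩ := Measure.exists_measurable_map_eq (μ : Measure Ω)
  refine ⟨g ∘ binaryUnit, hg.comp measurable_binaryUnit, ?_⟩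
  rw [← Measure.map_map hg measurable_binaryUnit, map_binaryUnit, hmap]

section sampler

variable {Ω : Type*} [MeasurableSpace Ω] [StandardBorelSpace Ω] [Nonempty Ω]

/-- A sample of the law `μ` made from random bits. -/
noncomputable def sampler (μ : ProbabilityMeasure Ω) : (ℕ → Bool) → Ω :=
  (exists_measurable_map_randomBits_eq μ).choose

lemma measurable_sampler (μ : ProbabilityMeasure Ω) : Measurable (sampler μ) :=
  (exists_measurable_map_randomBits_eq μ).choose_spec.1

lemma map_sampler (μ : ProbabilityMeasure Ω) : randomBits.map (sampler μ) = μ :=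
  (exists_measurable_map_randomBits_eq μ).choose_spec.2

end sampler

/-! ### From VOLUME to LCA algorithms -/

namespace ProbeTree

variable {α α' β : Type*}

/-- The procedure that translates the answer to a probe of `i` by `g i` before using it. -/
def adapt (g : ℕ → α → α') : ProbeTree α' β → ProbeTree α β
  | output b => output b
  | probe i next => probe i fun o => adapt g (next (o.map (g i)))

lemma run_adapt (g : ℕ → α → α') (ans : ℕ → Option α) (t : ProbeTree α' β) :
    (t.adapt g).run ans = t.run fun i => (ans i).map (g i) := by
  induction t with
  | output b => rfl
  | probe i next ih => simp only [adapt, run, ih]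

lemma numProbes_adapt (g : ℕ → α → α') (ans : ℕ → Option α) (t : ProbeTree α' β) :
    (t.adapt g).numProbes ans = t.numProbes fun i => (ans i).map (g i) := by
  induction t with
  | output b => rfl
  | probe i next ih => simp only [adapt, numProbes, ih]

end ProbeTree

section sharedBits

variable {Ω : Type*} [MeasurableSpace Ω] {n : ℕ}

/-- Reindexing independent random bits along an injection, in blocks. -/
lemma map_randomBits_blocks {ι κ : Type*} {f : ι × κ → ℕ} (hf : Function.Injective f) :
    randomBits.map (fun r (i : ι) (j : κ) => r (f (i, j))) =
      Measure.infinitePi fun _ : ι =>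
        Measure.infinitePi fun _ : κ => (PMF.uniformOfFintype Bool).toMeasure := by
  have h1 := Measure.map_infinitePi_infinitePi_of_inj
    (P := fun _ : ℕ => (PMF.uniformOfFintype Bool).toMeasure) hf
  rw [← Measure.infinitePi_map_curry, ← h1,
    Measure.map_map (by fun_prop) (by fun_prop)]
  rfl

/-- The private random bits of the nodes that are read off from a shared random string. -/
def LLLInstance.splitBits (I : LLLInstance Ω n) (r : ℕ → Bool) (v : Fin n) (j : ℕ) : Bool :=
  r (Nat.pair (I.id v) j)

lemma LLLInstance.map_splitBits (I : LLLInstance Ω n) :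
    randomBits.map I.splitBits = Measure.pi fun _ : Fin n => randomBits := by
  rw [← Measure.infinitePi_eq_pi]
  refine map_randomBits_blocks (f := fun p : Fin n × ℕ => Nat.pair (I.id p.1) p.2) ?_
  rintro ⟨v, j⟩ ⟨v', j'⟩ h
  obtain ⟨h1, h2⟩ := Nat.pair_eq_pair.1 h
  exact Prod.ext (I.id_injective h1) h2

lemma LLLInstance.measurable_splitBits (I : LLLInstance Ω n) : Measurable I.splitBits := by
  unfold LLLInstance.splitBits; fun_prop

/-- The LCA algorithm that cuts the shared random string into private strings of the nodes. -/
def VolumeAlgorithm.toLCA (A : VolumeAlgorithm Ω) : LCAAlgorithm Ω :=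
  fun r i => (A i).adapt fun j a => (a, fun k => r (Nat.pair j k))

lemma LLLInstance.map_oracle_info (I : LLLInstance Ω n) (r : ℕ → Bool) (i : ℕ) :
    ((I.oracle I.info i).map fun a => (a, fun k => r (Nat.pair i k))) =
      I.volumeOracle (I.splitBits r) i := by
  unfold LLLInstance.volumeOracle LLLInstance.oracle
  split_ifs with h
  · have hid := h.choose_spec
    simp only [Option.map_some]
    congr 2
    funext k
    rw [LLLInstance.splitBits, hid]
  · rfl

lemma VolumeAlgorithm.Solves.toLCA {A : VolumeAlgorithm Ω} {I : LLLInstance Ω n} {q δ : ℝ}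
    (h : A.Solves I q δ) : A.toLCA.Solves I q δ := by
  have hO : ∀ r : ℕ → Bool, (fun i => (I.oracle I.info i).map fun a =>
      (a, fun k => r (Nat.pair i k))) = I.volumeOracle (I.splitBits r) := fun r =>
    funext (I.map_oracle_info r)
  constructor
  · intro r v
    have := (h.1 (I.splitBits r) v).1
    rwa [VolumeAlgorithm.toLCA, ProbeTree.numProbes_adapt, hO]
  · refine le_trans ?_ h.2
    rw [← I.map_splitBits]
    -- The failure set is not known to be measurable; this direction of the pushforward formula
    -- holds for every set.
    refine le_trans (le_of_eq ?_) (Measure.le_map_apply I.measurable_splitBits.aemeasurable _)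
    congr 1
    ext r
    simp only [VolumeAlgorithm.toLCA, ProbeTree.run_adapt, hO, Set.mem_ofPred_eq,
      Set.mem_preimage]

end sharedBits

/-! ### The table of independent samples -/

section table

variable {Ω : Type*} [MeasurableSpace Ω] [StandardBorelSpace Ω] [Nonempty Ω] {n : ℕ}

/-- The position of the `j`-th bit used for the `k`-th sample of the variable `x`. -/
def bitIndex (x k j : ℕ) : ℕ := Nat.pair (Nat.pair x k) j

/-- The `c.2`-th sample of the variable `c.1`, made from the private bits of the node `owner c.1`. -/
noncomputable def sampleTable (law : ℕ → ProbabilityMeasure Ω) (owner : ℕ → Fin n) (c : ℕ × ℕ)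
    (r : Fin n → ℕ → Bool) : Ω :=
  sampler (law c.1) fun j => r (owner c.1) (bitIndex c.1 c.2 j)

variable (law : ℕ → ProbabilityMeasure Ω) (owner : ℕ → Fin n)

lemma measurable_sampleTable (c : ℕ × ℕ) : Measurable (sampleTable law owner c) := by
  unfold sampleTable
  exact (measurable_sampler _).comp (by fun_prop)

/-- The variable is encoded in the bit position, so distinct table entries read disjoint bits
whatever `owner` is. Realizing the `n` private strings inside a single string reduces the claim to
`map_randomBits_blocks`. -/
lemma map_bit_blocks :
    (Measure.pi fun _ : Fin n => randomBits).map
      (fun r (c : ℕ × ℕ) (j : ℕ) => r (owner c.1) (bitIndex c.1 c.2 j)) =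
    Measure.infinitePi fun _ : ℕ × ℕ => randomBits := by
  have h0 : randomBits.map (fun r (v : Fin n) (j : ℕ) => r (Nat.pair v j)) =
      Measure.pi fun _ : Fin n => randomBits := by
    rw [← Measure.infinitePi_eq_pi]
    refine map_randomBits_blocks (f := fun p : Fin n × ℕ => Nat.pair p.1 p.2) ?_
    rintro ⟨v, j⟩ ⟨v', j'⟩ h
    obtain ⟨h1, h2⟩ := Nat.pair_eq_pair.1 h
    exact Prod.ext (Fin.ext h1) h2
  rw [← h0, Measure.map_map (by fun_prop) (by fun_prop)]
  refine map_randomBits_blocks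
    (f := fun p : (ℕ × ℕ) × ℕ => Nat.pair (owner p.1.1) (bitIndex p.1.1 p.1.2 p.2)) ?_
  rintro ⟨⟨x, k⟩, j⟩ ⟨⟨x', k'⟩, j'⟩ h
  simp only [bitIndex, Nat.pair_eq_pair] at h
  simp_all

lemma map_sampleTable :
    (Measure.pi fun _ : Fin n => randomBits).map (fun r c => sampleTable law owner c r) =
      Measure.infinitePi fun c : ℕ × ℕ => (law c.1 : Measure Ω) := by
  have h := Measure.infinitePi_map_pi (fun _ : ℕ × ℕ => randomBits)
    (f := fun c => sampler (law c.1)) (fun c => measurable_sampler _)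
  simp only [map_sampler] at h
  rw [← h, ← map_bit_blocks owner, Measure.map_map]
  · rfl
  · exact measurable_pi_lambda _ fun c => (measurable_sampler _).comp (measurable_pi_apply c)
  · fun_prop

lemma iIndepFun_sampleTable :
    iIndepFun (sampleTable law owner) (Measure.pi fun _ : Fin n => randomBits) := by
  rw [iIndepFun_iff_map_fun_eq_infinitePi_map (measurable_sampleTable law owner),
    map_sampleTable]
  congr 1
  ext1 c
  have h1 := Measure.infinitePi_map_eval (fun c : ℕ × ℕ => (law c.1 : Measure Ω)) c
  rw [← map_sampleTable law owner, Measure.map_map (by fun_prop)] at h1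
  · exact h1.symm
  · exact measurable_pi_lambda _ fun c => measurable_sampleTable law owner c

/-- The sigma-algebra generated by the samples with index in `S`. -/
@[reducible]
noncomputable def tableAlgebra (S : Set (ℕ × ℕ)) : MeasurableSpace (Fin n → ℕ → Bool) :=
  ⨆ c ∈ S, MeasurableSpace.comap (sampleTable law owner c) inferInstance

lemma tableAlgebra_mono {S T : Set (ℕ × ℕ)} (h : S ⊆ T) :
    tableAlgebra law owner S ≤ tableAlgebra law owner T :=
  biSup_mono h

lemma indep_tableAlgebra {S T : Set (ℕ × ℕ)} (h : Disjoint S T) :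
    Indep (tableAlgebra law owner S) (tableAlgebra law owner T)
      (Measure.pi fun _ : Fin n => randomBits) :=
  indep_iSup_of_disjoint (fun c => (measurable_sampleTable law owner c).comap_le)
    (iIndepFun_sampleTable law owner) h

/-- The event that the assignment of the variables in `V` by their `N`-th samples lies in `B`. -/
def sampleEvent (V : Set ℕ) (B : Set (V → Ω)) (N : ℕ → ℕ) : Set (Fin n → ℕ → Bool) :=
  {r | (fun x : V => sampleTable law owner (x, N x) r) ∈ B}

lemma measurableSet_sampleEvent {V : Set ℕ} {B : Set (V → Ω)} (hB : MeasurableSet B)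
    (N : ℕ → ℕ) :
    MeasurableSet[tableAlgebra law owner {c | c.1 ∈ V ∧ c.2 = N c.1}]
      (sampleEvent law owner V B N) := by
  have hm : @Measurable _ _ (tableAlgebra law owner {c | c.1 ∈ V ∧ c.2 = N c.1}) _
      (fun r (x : V) => sampleTable law owner (x, N x) r) := by
    refine @measurable_pi_lambda _ _ _ (_) _ _ fun x => ?_
    refine Measurable.mono (comap_measurable (sampleTable law owner (↑x, N x))) ?_ le_rfl
    exact le_iSup₂_of_le ((x : ℕ), N x) ⟨x.2, rfl⟩ le_rfl
  exact hm hB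

lemma measure_sampleEvent {V : Set ℕ} {B : Set (V → Ω)} (hB : MeasurableSet B) (N : ℕ → ℕ) :
    (Measure.pi fun _ : Fin n => randomBits) (sampleEvent law owner V B N) =
      Measure.infinitePi (fun x : V => (law x : Measure Ω)) B := by
  have h := Measure.map_infinitePi_infinitePi_of_inj
    (P := fun c : ℕ × ℕ => (law c.1 : Measure Ω)) (f := fun x : V => ((x : ℕ), N x))
    (fun x y h => Subtype.ext (Prod.ext_iff.1 h).1)
  rw [← h, ← map_sampleTable law owner, Measure.map_map, Measure.map_apply _ hB]
  · rfl
  · exact (by fun_prop : Measurable fun (ω : ℕ × ℕ → Ω) (i : V) => ω (↑i, N ↑i)).comp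
      (measurable_pi_lambda _ fun c => measurable_sampleTable law owner c)
  · fun_prop
  · exact measurable_pi_lambda _ fun c => measurable_sampleTable law owner c

end table

/-- What a probe reveals in the VOLUME model. -/
abbrev NodeData (Ω : Type*) [MeasurableSpace Ω] := NodeInfo Ω × (ℕ → Bool)

/-! ### Parallel resampling and partial knowledge of the network -/

namespace Oracle

variable {Ω : Type*} [MeasurableSpace Ω]

section graph

variable (O : ℕ → Option (NodeData Ω))

/-- The variables of the node `i`. -/
def vars (i : ℕ) : Set ℕ := {x | ∃ a, O i = some a ∧ x ∈ a.1.vars}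

/-- The neighbours of the node `i`. -/
def adj (i : ℕ) : Set ℕ := {j | ∃ a, O i = some a ∧ j ∈ a.1.nbrs}

/-- The closed ball in the part of the graph known to the oracle. -/
def cball : ℕ → ℕ → Set ℕ
  | 0, w => {w}
  | m + 1, w => cball m w ∪ {j | ∃ u ∈ cball m w, j ∈ adj O u}

/-- The oracle describes all of a graph in which nodes with a common variable are adjacent. -/
structure IsNetwork : Prop where
  adj_of_share : ∀ {i j x}, x ∈ vars O i → x ∈ vars O j → i ≠ j → j ∈ adj O i
  symm : ∀ {i j}, j ∈ adj O i → i ∈ adj O j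
  irrefl : ∀ i, i ∉ adj O i

open Classical in
/-- The oracle that knows only the nodes in `E`. -/
noncomputable def restrict (E : Set ℕ) (i : ℕ) : Option (NodeData Ω) :=
  if i ∈ E then O i else none

end graph

variable {O : ℕ → Option (NodeData Ω)} {E : Set ℕ}

lemma restrict_of_mem {i : ℕ} (h : i ∈ E) : restrict O E i = O i := if_pos h

lemma restrict_eq_some {i : ℕ} {a : NodeData Ω} :
    restrict O E i = some a ↔ i ∈ E ∧ O i = some a := by
  unfold restrict; split_ifs with h <;> simp [h]

lemma vars_restrict {i : ℕ} (h : i ∈ E) : vars (restrict O E) i = vars O i := by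
  simp only [vars, restrict_of_mem h]

lemma adj_restrict {i : ℕ} (h : i ∈ E) : adj (restrict O E) i = adj O i := by
  simp only [adj, restrict_of_mem h]

lemma vars_restrict_subset (i : ℕ) : vars (restrict O E) i ⊆ vars O i := by
  rintro x ⟨a, ha, hx⟩
  exact ⟨a, (restrict_eq_some.1 ha).2, hx⟩

lemma adj_restrict_subset (i : ℕ) : adj (restrict O E) i ⊆ adj O i := by
  rintro x ⟨a, ha, hx⟩
  exact ⟨a, (restrict_eq_some.1 ha).2, hx⟩

lemma cball_mono {m m' : ℕ} (h : m ≤ m') (w : ℕ) : cball O m w ⊆ cball O m' w := by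
  induction h with
  | refl => exact subset_rfl
  | step _ ih => exact ih.trans Set.subset_union_left

lemma self_mem_cball (m w : ℕ) : w ∈ cball O m w := cball_mono (Nat.zero_le m) w rfl

lemma mem_cball_one {i j : ℕ} : j ∈ cball O 1 i ↔ j = i ∨ j ∈ adj O i := by
  simp [cball]

lemma mem_cball_succ {m i j : ℕ} :
    j ∈ cball O (m + 1) i ↔ j ∈ cball O m i ∨ ∃ u ∈ cball O m i, j ∈ adj O u := Iff.rfl

lemma cball_trans {m m' u v w : ℕ} (h : v ∈ cball O m u) (h' : w ∈ cball O m' v) :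
    w ∈ cball O (m + m') u := by
  induction m' generalizing w with
  | zero => rw [show w = v from h']; exact h
  | succ k ih =>
    rcases h' with h' | ⟨z, hz, hw⟩
    · exact cball_mono (by lia) u (ih h')
    · exact Or.inr ⟨z, ih hz, hw⟩

lemma cball_restrict_subset (m w : ℕ) : cball (restrict O E) m w ⊆ cball O m w := by
  induction m with
  | zero => exact subset_rfl
  | succ m ih =>
    rintro j (h | ⟨u, hu, hj⟩)
    · exact Or.inl (ih h)
    · exact Or.inr ⟨u, ih hu, adj_restrict_subset u hj⟩

/-- A known node shows its complete list of neighbours, so knowledge of a ball reveals the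
identifiers one step beyond it. -/
lemma cball_restrict_succ {m w : ℕ} (h : cball O m w ⊆ E) :
    cball (restrict O E) (m + 1) w = cball O (m + 1) w := by
  induction m with
  | zero =>
    have : w ∈ E := h rfl
    ext j
    rw [mem_cball_one, mem_cball_one, adj_restrict this]
  | succ m ih =>
    have ih' := ih ((cball_mono (Nat.le_succ m) w).trans h)
    ext j
    rw [mem_cball_succ, mem_cball_succ (m := m + 1), ih']
    refine or_congr_right (exists_congr fun u => and_congr_right fun hu => ?_)
    rw [adj_restrict (h hu)]

lemma cball_restrict {m w : ℕ} (h : cball O m w ⊆ E) :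
    cball (restrict O E) m w = cball O m w := by
  cases m with
  | zero => rfl
  | succ m => exact cball_restrict_succ ((cball_mono (Nat.le_succ m) w).trans h)

lemma IsNetwork.mem_cball_symm (hO : IsNetwork O) {m i j : ℕ} (h : j ∈ cball O m i) :
    i ∈ cball O m j := by
  induction m generalizing j with
  | zero => exact h.symm
  | succ m ih =>
    rcases h with h | ⟨u, hu, hj⟩
    · exact cball_mono (Nat.le_succ m) _ (ih h)
    · have h1 : u ∈ cball O 1 j := mem_cball_one.2 (Or.inr (hO.symm hj))
      have := cball_trans h1 (ih hu)
      rwa [add_comm] at this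

lemma IsNetwork.mem_cball_of_share (hO : IsNetwork O) {i j x : ℕ} (hi : x ∈ vars O i)
    (hj : x ∈ vars O j) : j ∈ cball O 1 i := by
  rw [mem_cball_one]
  by_cases h : j = i
  · exact Or.inl h
  · exact Or.inr (hO.adj_of_share hi hj (Ne.symm h))

lemma isSome_of_mem_adj (hO : IsNetwork O) {i j : ℕ} (h : j ∈ adj O i) : (O j).isSome := by
  obtain ⟨a, ha, -⟩ := hO.symm h
  simp [ha]

lemma exists_owner {i x : ℕ} (hx : x ∈ vars O i) :
    ∃ j a, O j = some a ∧ x ∈ a.1.vars ∧ ∀ j' < j, x ∉ vars O j' := by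
  classical
  have h : ∃ i, ∃ a, O i = some a ∧ x ∈ a.1.vars := ⟨i, hx⟩
  obtain ⟨a, ha, hxa⟩ := Nat.find_spec h
  exact ⟨_, a, ha, hxa, fun j' hj' => Nat.find_min h hj'⟩

variable [StandardBorelSpace Ω] [Nonempty Ω]

open Classical in
/-- The `k`-th sample of the variable `x` made from the bits of a node. -/
noncomputable def nodeSample (a : NodeData Ω) (x k : ℕ) : Ω :=
  if h : x ∈ a.1.vars then sampler (a.1.law ⟨x, h⟩) fun j => a.2 (bitIndex x k j)
  else Classical.arbitrary Ω

open Classical in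
/-- The `k`-th sample of the variable `x`, made from the bits of the node of smallest identifier
that depends on `x`. -/
noncomputable def tab (O : ℕ → Option (NodeData Ω)) (x k : ℕ) : Ω :=
  if h : ∃ i, ∃ a, O i = some a ∧ x ∈ a.1.vars then nodeSample (Nat.find_spec h).choose x k
  else Classical.arbitrary Ω

lemma tab_eq {i x k : ℕ} {a : NodeData Ω} (ha : O i = some a) (hx : x ∈ a.1.vars)
    (hmin : ∀ j < i, x ∉ vars O j) : tab O x k = nodeSample a x k := by
  classical
  have h : ∃ i, ∃ a, O i = some a ∧ x ∈ a.1.vars := ⟨i, a, ha, hx⟩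
  have hfind : Nat.find h = i := by
    refine le_antisymm (Nat.find_min' h ⟨a, ha, hx⟩) ?_
    by_contra! hlt
    exact hmin _ hlt (Nat.find_spec h)
  have hO : O (Nat.find h) = some a := by rw [hfind]; exact ha
  have hch : (Nat.find_spec h).choose = a :=
    Option.some.inj ((Nat.find_spec h).choose_spec.1.symm.trans hO)
  unfold tab
  rw [dif_pos h, hch]

lemma IsNetwork.tab_restrict (hO : IsNetwork O) {i x : ℕ} (hE : cball O 1 i ⊆ E)
    (hx : x ∈ vars O i) (k : ℕ) : tab (restrict O E) x k = tab O x k := by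
  obtain ⟨j, a, ha, hxa, hmin⟩ := exists_owner hx
  have hj : j ∈ E := hE (hO.mem_cball_of_share hx ⟨a, ha, hxa⟩)
  rw [tab_eq ha hxa hmin, tab_eq (restrict_eq_some.2 ⟨hj, ha⟩) hxa]
  exact fun j' hj' h => hmin j' hj' (vars_restrict_subset j' h)

/-- The neighbourhood of the node `i` is known, and its bad event happens when every variable `x`
takes its `N x`-th sample. -/
def Bad (O : ℕ → Option (NodeData Ω)) (N : ℕ → ℕ) (i : ℕ) : Prop :=
  ∃ a, O i = some a ∧ (∀ j ∈ a.1.nbrs, (O j).isSome) ∧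
    (fun x : a.1.vars => tab O x (N x)) ∈ a.1.bad

lemma bad_congr {N N' : ℕ → ℕ} {i : ℕ} (h : ∀ x ∈ vars O i, N x = N' x) (hb : Bad O N i) :
    Bad O N' i := by
  obtain ⟨a, ha, hn, hb⟩ := hb
  refine ⟨a, ha, hn, ?_⟩
  convert hb using 3 with x
  exact (h x ⟨a, ha, x.2⟩).symm

/-- `Bad` demands that all neighbours be known. The owners of all variables of `i` are then known
and the values are the true ones, which makes badness monotone in the knowledge. -/
lemma IsNetwork.bad_of_restrict (hO : IsNetwork O) {N : ℕ → ℕ} {i : ℕ}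
    (hb : Bad (restrict O E) N i) : Bad O N i := by
  obtain ⟨a, ha, hn, hb⟩ := hb
  obtain ⟨hi, ha⟩ := restrict_eq_some.1 ha
  have hnE : ∀ j ∈ a.1.nbrs, j ∈ E ∧ (O j).isSome := by
    intro j hj
    obtain ⟨b, hb⟩ := Option.isSome_iff_exists.1 (hn j hj)
    obtain ⟨h1, h2⟩ := restrict_eq_some.1 hb
    exact ⟨h1, by simp [h2]⟩
  have hE : cball O 1 i ⊆ E := by
    intro j hj
    rcases mem_cball_one.1 hj with rfl | ⟨b, hb, hj⟩
    · exact hi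
    · rw [ha] at hb
      exact (hnE j (Option.some.inj hb ▸ hj)).1
  refine ⟨a, ha, fun j hj => (hnE j hj).2, ?_⟩
  convert hb using 2 with x
  exact (hO.tab_restrict hE ⟨a, ha, x.2⟩ _).symm

lemma IsNetwork.bad_restrict (hO : IsNetwork O) {N : ℕ → ℕ} {i : ℕ} (hE : cball O 1 i ⊆ E)
    (hb : Bad O N i) : Bad (restrict O E) N i := by
  obtain ⟨a, ha, hn, hb⟩ := hb
  refine ⟨a, restrict_eq_some.2 ⟨hE (self_mem_cball 1 i), ha⟩, fun j hj => ?_, ?_⟩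
  · rw [restrict_of_mem (hE (mem_cball_one.2 (Or.inr ⟨a, ha, hj⟩)))]
    exact hn j hj
  · convert hb using 2 with x
    exact hO.tab_restrict hE ⟨a, ha, x.2⟩ _

/-- The nodes that are resampled in a round: the bad nodes without bad neighbours of smaller
identifier. -/
def sel (O : ℕ → Option (NodeData Ω)) (N : ℕ → ℕ) : Set ℕ :=
  {i | Bad O N i ∧ ∀ j ∈ adj O i, Bad O N j → i < j}

open Classical in
/-- The number of times that each variable has been resampled after `t` rounds, when only nodes in
`A s` may be resampled in round `s`. -/
noncomputable def counts (O : ℕ → Option (NodeData Ω)) (A : ℕ → Set ℕ) : ℕ → ℕ → ℕ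
  | 0, _ => 0
  | t + 1, x => counts O A t x + if ∃ i ∈ sel O (counts O A t) ∩ A t, x ∈ vars O i then 1 else 0

/-- Selection depends on the badness of `i` and its neighbours, and each of these needs its own
neighbourhood and counters. -/
lemma IsNetwork.mem_sel_restrict_iff (hO : IsNetwork O) {N N' : ℕ → ℕ} {i : ℕ}
    (h : ∀ j ∈ cball O 1 i, cball O 1 j ⊆ E ∧ ∀ x ∈ vars O j, N' x = N x) :
    i ∈ sel (restrict O E) N' ↔ i ∈ sel O N := by
  have hbad : ∀ j ∈ cball O 1 i, (Bad (restrict O E) N' j ↔ Bad O N j) := fun j hj =>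
    ⟨fun hb => bad_congr (h j hj).2 (hO.bad_of_restrict hb),
      fun hb => hO.bad_restrict (h j hj).1 (bad_congr (fun x hx => ((h j hj).2 x hx).symm) hb)⟩
  have hi : i ∈ E := (h i (self_mem_cball 1 i)).1 (self_mem_cball 1 i)
  simp only [sel, Set.mem_ofPred_eq]
  refine and_congr (hbad i (self_mem_cball 1 i)) ?_
  rw [adj_restrict hi]
  exact forall₂_congr fun j hj => by rw [hbad j (mem_cball_one.2 (Or.inr hj))]

lemma counts_congr_step {O' : ℕ → Option (NodeData Ω)} {A A' : ℕ → Set ℕ} {t x : ℕ}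
    (h : counts O' A' t x = counts O A t x)
    (hsel : (∃ i ∈ sel O' (counts O' A' t) ∩ A' t, x ∈ vars O' i) ↔
      ∃ i ∈ sel O (counts O A t) ∩ A t, x ∈ vars O i) :
    counts O' A' (t + 1) x = counts O A (t + 1) x := by
  simp only [counts, h]
  by_cases h' : ∃ i ∈ sel O (counts O A t) ∩ A t, x ∈ vars O i
  · rw [if_pos h', if_pos (hsel.2 h')]
  · rw [if_neg h', if_neg (mt hsel.1 h')]

/-- In the first rounds, the process run on a known ball agrees with the global process. -/
lemma IsNetwork.counts_restrict_early (hO : IsNetwork O) {A : ℕ → Set ℕ} {T : ℕ}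
    (hA : ∀ t < T, A t = Set.univ) {t u x : ℕ} (ht : t ≤ T) (hE : cball O (2 * t + 1) u ⊆ E)
    (hx : x ∈ vars O u) :
    counts (restrict O E) A t x = counts O (fun _ => Set.univ) t x := by
  induction t generalizing u x with
  | zero => rfl
  | succ t ih =>
    -- A node touching `x` is within distance 1 of `u`, and its selection involves neighbours within
    -- distance 2 of `u`. Hence each round costs 2 in the radius.
    have key : ∀ i, x ∈ vars O i → (i ∈ sel (restrict O E) (counts (restrict O E) A t) ↔
        i ∈ sel O (counts O (fun _ => Set.univ) t)) := by
      intro i hi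
      have hiu := hO.mem_cball_of_share hx hi
      refine hO.mem_sel_restrict_iff fun j hj => ?_
      have hju : j ∈ cball O 2 u := cball_trans hiu hj
      refine ⟨fun k hk => hE (cball_mono (by lia) u (cball_trans hju hk)), fun y hy => ?_⟩
      refine ih (by lia) (fun k hk => hE ?_) hy
      exact cball_mono (by lia) u (cball_trans hju hk)
    refine counts_congr_step (ih (by lia) ((cball_mono (by lia) u).trans hE) hx) ?_
    simp only [hA t (by lia), Set.inter_univ]
    refine exists_congr fun i => ⟨fun ⟨h1, h2⟩ => ?_, fun ⟨h1, h2⟩ => ?_⟩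
    · have h3 := vars_restrict_subset i h2
      exact ⟨(key i h3).1 h1, h3⟩
    · refine ⟨(key i h2).2 h1, ?_⟩
      rwa [vars_restrict (hE (cball_mono (by lia) u (hO.mem_cball_of_share hx h2)))]

/-- The nodes reachable from `v` by steps of length at most `2` to nodes of `M`. -/
def reach (O : ℕ → Option (NodeData Ω)) (M : Set ℕ) (v : ℕ) : Set ℕ :=
  {w | Relation.ReflTransGen (fun a b => b ∈ cball O 2 a ∧ b ∈ M) v w}

/-- If late resampling is confined to `M`, then the process run around the cluster of `v` and with
late resampling confined to it agrees with the global process there. -/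
lemma IsNetwork.counts_restrict_late (hO : IsNetwork O) {A : ℕ → Set ℕ} {M : Set ℕ} {T K v : ℕ}
    (hA : ∀ t < T, A t = Set.univ) (hA' : ∀ t, T ≤ t → A t = reach O M v)
    (hE : ∀ w ∈ reach O M v, cball O (2 * T + 2) w ⊆ E) (hE2 : ∀ w ∈ reach O M v, cball O 3 w ⊆ E)
    (hlate : ∀ t, T ≤ t → t < K → sel O (counts O (fun _ => Set.univ) t) ⊆ M)
    {t u w x : ℕ} (hTt : T ≤ t) (ht : t ≤ K) (hw : w ∈ reach O M v) (hu : u ∈ cball O 1 w)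
    (hx : x ∈ vars O u) :
    counts (restrict O E) A t x = counts O (fun _ => Set.univ) t x := by
  induction t, hTt using Nat.le_induction generalizing u w x with
  | base =>
    refine hO.counts_restrict_early hA le_rfl (fun k hk => hE w hw ?_) hx
    exact cball_mono (by lia) w (cball_trans hu hk)
  | succ t hTt ih =>
    have key : ∀ i ∈ reach O M v, (i ∈ sel (restrict O E) (counts (restrict O E) A t) ↔
        i ∈ sel O (counts O (fun _ => Set.univ) t)) := by
      intro i hi
      refine hO.mem_sel_restrict_iff fun j hj => ⟨fun k hk => ?_, fun y hy => ?_⟩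
      · exact hE2 i hi (cball_mono (by lia) i (cball_trans hj hk))
      · exact ih (by lia) hi hj hy
    refine counts_congr_step (ih (by lia) hw hu hx) ?_
    rw [hA' t hTt, Set.inter_univ]
    refine exists_congr fun i => ⟨fun ⟨⟨h1, h1'⟩, h2⟩ => ?_, fun ⟨h1, h2⟩ => ?_⟩
    · exact ⟨(key i h1').1 h1, vars_restrict_subset i h2⟩
    -- A resampled node sharing a variable with `u` is within distance 2 of `w`, which is the step
    -- length of `reach`. So nothing outside the cluster touches these variables.
    · have hiw : i ∈ cball O 2 w := cball_trans hu (hO.mem_cball_of_share hx h2)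
      have hi : i ∈ reach O M v := hw.tail ⟨hiw, hlate t hTt (by lia) h1⟩
      refine ⟨⟨(key i hi).2 h1, hi⟩, ?_⟩
      rwa [vars_restrict (hE2 i hi (self_mem_cball _ i))]

end Oracle

/-! ### Exploration by probes -/

namespace Oracle

variable {Ω : Type*} [MeasurableSpace Ω]

section exploration

variable {β : Type*}

open Classical in
/-- Some unprobed node next to the probed ones (or the start `v`) that is wanted according to `W`. -/
noncomputable def nextProbe (W : (ℕ → Option (NodeData Ω)) → Set ℕ) (v : ℕ)
    (kn : ℕ → Option (NodeData Ω)) : Option ℕ :=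
  if h : ∃ i, kn i = none ∧ (i = v ∨ ∃ u, i ∈ adj kn u) ∧ i ∈ W kn then some h.choose else none

lemma nextProbe_eq_some {W : (ℕ → Option (NodeData Ω)) → Set ℕ} {v : ℕ}
    {kn : ℕ → Option (NodeData Ω)} {i : ℕ} (h : nextProbe W v kn = some i) :
    kn i = none ∧ (i = v ∨ ∃ u, i ∈ adj kn u) ∧ i ∈ W kn := by
  unfold nextProbe at h
  split_ifs at h with h'
  rw [← Option.some.inj h]
  exact h'.choose_spec

lemma nextProbe_eq_none {W : (ℕ → Option (NodeData Ω)) → Set ℕ} {v : ℕ}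
    {kn : ℕ → Option (NodeData Ω)} (h : nextProbe W v kn = none) {i : ℕ}
    (hi : i = v ∨ ∃ u, i ∈ adj kn u) (hW : i ∈ W kn) : kn i ≠ none := by
  unfold nextProbe at h
  split_ifs at h with h'
  exact fun h0 => h' ⟨i, h0, hi, hW⟩

/-- Probe wanted nodes one after the other, at most `fuel` of them, and output a function of the
knowledge gained. -/
noncomputable def explore (W : (ℕ → Option (NodeData Ω)) → Set ℕ)
    (F : (ℕ → Option (NodeData Ω)) → β) (v : ℕ) :
    ℕ → (ℕ → Option (NodeData Ω)) → ProbeTree (NodeData Ω) β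
  | 0, kn => .output (F kn)
  | fuel + 1, kn =>
    (nextProbe W v kn).elim (.output (F kn)) fun i =>
      .probe i fun o => explore W F v fuel (Function.update kn i o)

variable (W : (ℕ → Option (NodeData Ω)) → Set ℕ) (F : (ℕ → Option (NodeData Ω)) → β) (v : ℕ)

lemma numProbes_explore_le (ans : ℕ → Option (NodeData Ω)) (fuel : ℕ)
    (kn : ℕ → Option (NodeData Ω)) : (explore W F v fuel kn).numProbes ans ≤ fuel := by
  induction fuel generalizing kn with
  | zero => simp [explore, ProbeTree.numProbes]
  | succ fuel ih =>
    rw [explore]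
    cases nextProbe W v kn with
    | none => simp [ProbeTree.numProbes]
    | some i => simpa [ProbeTree.numProbes] using ih _

lemma connected_explore (ans : ℕ → Option (NodeData Ω)) (fuel : ℕ)
    (kn : ℕ → Option (NodeData Ω)) (S : Set ℕ) (hv : v ∈ S) (hS : ∀ u, adj kn u ⊆ S) :
    (explore W F v fuel kn).Connected ans (fun a => a.1.nbrs) S := by
  induction fuel generalizing kn S with
  | zero => simp [explore, ProbeTree.Connected]
  | succ fuel ih =>
    rw [explore]
    cases h : nextProbe W v kn with
    | none => simp [ProbeTree.Connected]
    | some i =>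
      simp only [Option.elim_some, ProbeTree.Connected]
      constructor
      · rcases (nextProbe_eq_some h).2.1 with rfl | ⟨u, hu⟩
        · exact hv
        · exact hS u hu
      · refine ih _ _ (Or.inl hv) fun u j hj => ?_
        obtain ⟨a, ha, hj⟩ := hj
        by_cases hu : u = i
        · subst hu
          rw [Function.update_self] at ha
          exact Or.inr ⟨a, ha, hj⟩
        · rw [Function.update_of_ne hu] at ha
          exact Or.inl (hS u ⟨a, ha, hj⟩)

lemma restrict_insert (O : ℕ → Option (NodeData Ω)) (E : Set ℕ) (i : ℕ) :
    restrict O (insert i E) = Function.update (restrict O E) i (O i) := by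
  funext j
  by_cases h : j = i
  · subst h; simp [restrict]
  · have : j ∈ insert i E ↔ j ∈ E := by rw [Set.mem_insert_iff]; simp [h]
    rw [Function.update_of_ne h]
    by_cases hj : j ∈ E
    · rw [restrict_of_mem hj, restrict_of_mem (this.2 hj)]
    · simp only [restrict, if_neg hj, if_neg (mt this.1 hj)]

/-- If only nodes in a small finite set are ever wanted, then the exploration ends with
everything that is wanted and reachable being known. -/
lemma run_explore (O : ℕ → Option (NodeData Ω)) (B : Finset ℕ)
    (hB : ∀ E : Set ℕ, ∀ i, (i = v ∨ ∃ u, i ∈ adj (restrict O E) u) →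
      i ∈ W (restrict O E) → i ∈ B ∧ (O i).isSome)
    (fuel : ℕ) (E : Finset ℕ) (hfuel : (B \ E).card ≤ fuel) :
    ∃ E' : Set ℕ, (∀ i, (i = v ∨ ∃ u, i ∈ adj (restrict O E') u) →
        i ∈ W (restrict O E') → i ∈ E') ∧
      (explore W F v fuel (restrict O E)).run O = F (restrict O E') := by
  induction fuel generalizing E with
  | zero =>
    refine ⟨E, fun i hi hW => ?_, rfl⟩
    have := (hB E i hi hW).1
    have h0 : B \ E = ∅ := Finset.card_eq_zero.1 (Nat.le_zero.1 hfuel)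
    exact Finset.sdiff_eq_empty_iff_subset.1 h0 this
  | succ fuel ih =>
    rw [explore]
    cases h : nextProbe W v (restrict O E) with
    | none =>
      refine ⟨E, fun i hi hW => ?_, rfl⟩
      by_contra hiE
      exact nextProbe_eq_none h hi hW (by simp only [restrict, if_neg hiE])
    | some i =>
      obtain ⟨h1, h2, h3⟩ := nextProbe_eq_some h
      obtain ⟨hiB, hsome⟩ := hB E i h2 h3
      -- Unprobed nodes are recognized by the answer `none`. Since `i` exists in the network, it
      -- cannot have been probed already, so each probe uses up a new element of `B`.
      have hiE : i ∉ E := by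
        intro hiE
        rw [restrict_of_mem (show i ∈ (E : Set ℕ) from hiE)] at h1
        simp [h1] at hsome
      have hcard : (B \ insert i E).card ≤ fuel := by
        have : (B \ insert i E).card < (B \ E).card := by
          refine Finset.card_lt_card ?_
          rw [Finset.ssubset_iff]
          refine ⟨i, by simp, ?_⟩
          intro j hj
          rcases Finset.mem_insert.1 hj with rfl | hj
          · simp [hiB, hiE]
          · simp only [Finset.mem_sdiff, Finset.mem_insert, not_or] at hj ⊢
            exact ⟨hj.1, hj.2.2⟩
        lia
      obtain ⟨E', hE', hrun⟩ := ih (insert i E) hcard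
      refine ⟨E', hE', ?_⟩
      rw [← hrun, Finset.coe_insert, restrict_insert]
      rfl

end exploration

/-! ### Layered evidence for a resampling -/

section evidence

variable [StandardBorelSpace Ω] [Nonempty Ω]

open Classical in
/-- The number of layers that contain a node depending on the variable `x`. -/
noncomputable def cnt (O : ℕ → Option (NodeData Ω)) : List (Finset (ℕ × Bool)) → ℕ → ℕ
  | [], _ => 0
  | L :: Ls, x => cnt O Ls x + if ∃ l ∈ L, x ∈ vars O l.1 then 1 else 0

/-- The nodes with flag `true` are bad when the variables have been resampled by the nodes of the
later layers. -/
def Consistent (O : ℕ → Option (NodeData Ω)) : List (Finset (ℕ × Bool)) → Prop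
  | [] => True
  | L :: Ls => (∀ l ∈ L, l.2 = true → Bad O (cnt O Ls) l.1) ∧ Consistent O Ls

/-- A layer consists of known nodes of `R` without common variables. -/
def LayerOK (O : ℕ → Option (NodeData Ω)) (R : Set ℕ) (L : Finset (ℕ × Bool)) : Prop :=
  (∀ l ∈ L, (O l.1).isSome ∧ l.1 ∈ R) ∧
    ∀ l ∈ L, ∀ l' ∈ L, l ≠ l' → Disjoint (vars O l.1) (vars O l'.1)

/-- Each node of a layer is within distance `2` of a node of the previous layer. -/
def Linked (O : ℕ → Option (NodeData Ω)) :
    Finset (ℕ × Bool) → List (Finset (ℕ × Bool)) → Prop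
  | _, [] => True
  | L, L' :: Ls => (∀ l' ∈ L', ∃ l ∈ L, l'.1 ∈ cball O 2 l.1) ∧ Linked O L' Ls

/-- The number of nodes with flag `b` in the layers. -/
def numLabels (b : Bool) (Ls : List (Finset (ℕ × Bool))) : ℕ :=
  (Ls.map fun L => (L.filter fun l => l.2 = b).card).sum

/-- There are layers of nodes of `R` that witness a resampling of `v`, with at least `S` nodes
whose badness is checked, and at least as many of these as of the others. -/
def Evidence (O : ℕ → Option (NodeData Ω)) (v h S : ℕ) (R : Set ℕ) : Prop :=
  ∃ Ls : List (Finset (ℕ × Bool)), Ls.length = h ∧ Linked O {(v, true)} Ls ∧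
    (∀ L ∈ {(v, true)} :: Ls, LayerOK O R L) ∧ Consistent O ({(v, true)} :: Ls) ∧
    numLabels false ({(v, true)} :: Ls) ≤ numLabels true ({(v, true)} :: Ls) ∧
    S ≤ numLabels true ({(v, true)} :: Ls)

variable {O : ℕ → Option (NodeData Ω)} {E : Set ℕ}

omit [StandardBorelSpace Ω] [Nonempty Ω] in
lemma cnt_restrict {Ls : List (Finset (ℕ × Bool))} (h : ∀ L ∈ Ls, ∀ l ∈ L, l.1 ∈ E) :
    cnt (restrict O E) Ls = cnt O Ls := by
  induction Ls with
  | nil => rfl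
  | cons L Ls ih =>
    funext x
    have hL : (∃ l ∈ L, x ∈ vars (restrict O E) l.1) ↔ ∃ l ∈ L, x ∈ vars O l.1 :=
      exists_congr fun l => and_congr_right fun hl => by
        rw [vars_restrict (h L (by simp) l hl)]
    rw [cnt, cnt, ih fun L hL => h L (by simp [hL])]
    by_cases h' : ∃ l ∈ L, x ∈ vars O l.1
    · rw [if_pos h', if_pos (hL.2 h')]
    · rw [if_neg h', if_neg (mt hL.1 h')]

lemma IsNetwork.consistent_of_restrict (hO : IsNetwork O) {Ls : List (Finset (ℕ × Bool))}
    (h : ∀ L ∈ Ls, ∀ l ∈ L, l.1 ∈ E) (hc : Consistent (restrict O E) Ls) : Consistent O Ls := by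
  induction Ls with
  | nil => trivial
  | cons L Ls ih =>
    have h' : ∀ L ∈ Ls, ∀ l ∈ L, l.1 ∈ E := fun L hL => h L (by simp [hL])
    refine ⟨fun l hl hl2 => ?_, ih h' hc.2⟩
    rw [← cnt_restrict h']
    exact hO.bad_of_restrict (hc.1 l hl hl2)

lemma IsNetwork.consistent_restrict (hO : IsNetwork O) {Ls : List (Finset (ℕ × Bool))}
    (h : ∀ L ∈ Ls, ∀ l ∈ L, cball O 1 l.1 ⊆ E) (hc : Consistent O Ls) :
    Consistent (restrict O E) Ls := by
  induction Ls with
  | nil => trivial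
  | cons L Ls ih =>
    have h' : ∀ L ∈ Ls, ∀ l ∈ L, cball O 1 l.1 ⊆ E := fun L hL => h L (by simp [hL])
    refine ⟨fun l hl hl2 => ?_, ih h' hc.2⟩
    rw [cnt_restrict fun L hL l hl => h' L hL l hl (self_mem_cball 1 _)]
    exact hO.bad_restrict (h L (by simp) l hl) (hc.1 l hl hl2)

omit [StandardBorelSpace Ω] [Nonempty Ω] in
lemma linked_of_restrict {L : Finset (ℕ × Bool)} {Ls : List (Finset (ℕ × Bool))}
    (h : Linked (restrict O E) L Ls) : Linked O L Ls := by
  induction Ls generalizing L with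
  | nil => trivial
  | cons L' Ls ih =>
    refine ⟨fun l' hl' => ?_, ih h.2⟩
    obtain ⟨l, hl, hb⟩ := h.1 l' hl'
    exact ⟨l, hl, cball_restrict_subset _ _ hb⟩

omit [StandardBorelSpace Ω] [Nonempty Ω] in
lemma linked_restrict {L : Finset (ℕ × Bool)} {Ls : List (Finset (ℕ × Bool))}
    (hE : ∀ L' ∈ L :: Ls, ∀ l ∈ L', cball O 1 l.1 ⊆ E) (h : Linked O L Ls) :
    Linked (restrict O E) L Ls := by
  induction Ls generalizing L with
  | nil => trivial
  | cons L' Ls ih =>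
    refine ⟨fun l' hl' => ?_, ih (fun L'' hL'' => hE L'' (List.mem_cons_of_mem _ hL'')) h.2⟩
    obtain ⟨l, hl, hb⟩ := h.1 l' hl'
    exact ⟨l, hl, by rwa [cball_restrict_succ (hE L (by simp) l hl)]⟩

omit [StandardBorelSpace Ω] [Nonempty Ω] in
lemma mem_of_isSome_restrict {i : ℕ} (h : (restrict O E i).isSome) : i ∈ E := by
  obtain ⟨a, ha⟩ := Option.isSome_iff_exists.1 h
  exact (restrict_eq_some.1 ha).1

/-- Monotonicity is inherited from `Bad`: partial knowledge gives no false evidence, so an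
exploration guided by it stays near the true cluster. -/
lemma IsNetwork.evidence_of_restrict (hO : IsNetwork O) {v h S : ℕ} {R R' : Set ℕ}
    (hR : R ⊆ R') (hev : Evidence (restrict O E) v h S R) : Evidence O v h S R' := by
  obtain ⟨Ls, hlen, hlink, hok, hcons, h1, h2⟩ := hev
  have hE : ∀ L ∈ {(v, true)} :: Ls, ∀ l ∈ L, l.1 ∈ E := fun L hL l hl =>
    mem_of_isSome_restrict ((hok L hL).1 l hl).1
  refine ⟨Ls, hlen, linked_of_restrict hlink, fun L hL => ⟨fun l hl => ⟨?_, ?_⟩, ?_⟩,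
    hO.consistent_of_restrict hE hcons, h1, h2⟩
  · have := ((hok L hL).1 l hl).1
    rwa [restrict_of_mem (hE L hL l hl)] at this
  · exact hR ((hok L hL).1 l hl).2
  · intro l hl l' hl' hne
    have := (hok L hL).2 l hl l' hl' hne
    rwa [vars_restrict (hE L hL l hl), vars_restrict (hE L hL l' hl')] at this

/-- A witness mentions only nodes of `R`, and badness and links of length 2 are visible once the
closed neighbourhoods of these nodes are known. -/
lemma IsNetwork.evidence_restrict (hO : IsNetwork O) {v h S : ℕ} {R R' : Set ℕ}
    (hR : R ⊆ R') (hRE : ∀ i ∈ R, cball O 1 i ⊆ E) (hev : Evidence O v h S R) :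
    Evidence (restrict O E) v h S R' := by
  obtain ⟨Ls, hlen, hlink, hok, hcons, h1, h2⟩ := hev
  have hE : ∀ L ∈ {(v, true)} :: Ls, ∀ l ∈ L, cball O 1 l.1 ⊆ E := fun L hL l hl =>
    hRE _ ((hok L hL).1 l hl).2
  have hE' : ∀ L ∈ {(v, true)} :: Ls, ∀ l ∈ L, l.1 ∈ E := fun L hL l hl =>
    hE L hL l hl (self_mem_cball 1 _)
  refine ⟨Ls, hlen, linked_restrict hE hlink, fun L hL => ⟨fun l hl => ⟨?_, ?_⟩, ?_⟩,
    hO.consistent_restrict hE hcons, h1, h2⟩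
  · rw [restrict_of_mem (hE' L hL l hl)]
    exact ((hok L hL).1 l hl).1
  · exact hR ((hok L hL).1 l hl).2
  · intro l hl l' hl' hne
    rw [vars_restrict (hE' L hL l hl), vars_restrict (hE' L hL l' hl')]
    exact (hok L hL).2 l hl l' hl' hne

lemma Evidence.isSome {v h S : ℕ} {R : Set ℕ} (hev : Evidence O v h S R) : (O v).isSome := by
  obtain ⟨Ls, -, -, hok, -⟩ := hev
  exact ((hok _ (List.mem_cons_self ..)).1 (v, true) (by simp)).1

/-- The nodes whose resampling has evidence within distance `R`. -/
def suspects (O : ℕ → Option (NodeData Ω)) (h S R : ℕ) : Set ℕ :=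
  {w | Evidence O w h S (cball O R w)}

/-- The nodes within distance `ρ` of the cluster of `v`. -/
def clusterBall (O : ℕ → Option (NodeData Ω)) (h S R ρ v : ℕ) : Set ℕ :=
  {i | ∃ w ∈ reach O (suspects O h S R) v, i ∈ cball O ρ w}

variable {h S R ρ v : ℕ}

lemma IsNetwork.suspects_restrict_subset (hO : IsNetwork O) :
    suspects (restrict O E) h S R ⊆ suspects O h S R := fun _ hw =>
  hO.evidence_of_restrict (cball_restrict_subset _ _) hw

lemma IsNetwork.reach_restrict_subset (hO : IsNetwork O) :
    reach (restrict O E) (suspects (restrict O E) h S R) v ⊆ reach O (suspects O h S R) v :=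
  fun _ hw => Relation.ReflTransGen.mono
    (fun _ _ h => ⟨cball_restrict_subset _ _ h.1, hO.suspects_restrict_subset h.2⟩) _ _ hw

lemma IsNetwork.clusterBall_restrict_subset (hO : IsNetwork O) :
    clusterBall (restrict O E) h S R ρ v ⊆ clusterBall O h S R ρ v := by
  rintro i ⟨w, hw, hi⟩
  exact ⟨w, hO.reach_restrict_subset hw, cball_restrict_subset _ _ hi⟩

/-- When everything that is wanted is known, the known cluster is the true cluster. -/
lemma IsNetwork.reach_restrict (hO : IsNetwork O) (hρ : R + 4 ≤ ρ)
    (hE : ∀ i, (i = v ∨ ∃ u, i ∈ adj (restrict O E) u) →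
      i ∈ clusterBall (restrict O E) h S R ρ v → i ∈ E) :
    reach (restrict O E) (suspects (restrict O E) h S R) v = reach O (suspects O h S R) v ∧
      ∀ w ∈ reach O (suspects O h S R) v, cball O ρ w ⊆ E := by
  -- The centre is known, being the start or a node with evidence. The ball is then filled sphere by
  -- sphere: the next sphere is adjacent to known nodes and wanted, hence known as well.
  have hball : ∀ w ∈ reach (restrict O E) (suspects (restrict O E) h S R) v,
      cball O ρ w ⊆ E := by
    intro w hw
    have hwE : w ∈ E := by
      rcases Relation.ReflTransGen.cases_tail hw with rfl | ⟨u, -, -, h2⟩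
      · exact hE _ (Or.inl rfl) ⟨_, hw, self_mem_cball _ _⟩
      · exact mem_of_isSome_restrict (Evidence.isSome h2)
    have key : ∀ m ≤ ρ, cball O m w ⊆ E := by
      intro m
      induction m with
      | zero => rintro - j rfl; exact hwE
      | succ m ih =>
        intro hm j hj
        have hsub := ih (by lia)
        rcases hj with hj | ⟨u, hu, hju⟩
        · exact hsub hj
        · refine hE j (Or.inr ⟨u, by rwa [adj_restrict (hsub hu)]⟩) ⟨w, hw, ?_⟩
          refine cball_mono hm w ?_
          rw [cball_restrict_succ hsub]
          exact Or.inr ⟨u, hu, hju⟩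
    exact key ρ le_rfl
  have heq : reach (restrict O E) (suspects (restrict O E) h S R) v =
      reach O (suspects O h S R) v := by
    refine subset_antisymm hO.reach_restrict_subset fun w hw => ?_
    induction hw with
    | refl => exact .refl
    | @tail u w _ huw ih =>
      have hu := hball u ih
      refine Relation.ReflTransGen.tail ih ⟨?_, ?_⟩
      · rw [cball_restrict ((cball_mono (by lia) u).trans hu)]
        exact huw.1
      -- A true suspect within distance 2 of a cluster node needs radius `R + 1` for its evidence to
      -- be visible. This lies within the margin `ρ` already known around that cluster node.
      · have hw : cball O (R + 1) w ⊆ E := fun j hj =>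
          hu (cball_mono (by lia) u (cball_trans huw.1 hj))
        refine hO.evidence_restrict ?_ (fun i hi j hj => hw (cball_trans hi hj)) huw.2
        rw [cball_restrict ((cball_mono (by lia) w).trans hw)]
  exact ⟨heq, fun w hw => hball w (heq ▸ hw)⟩

end evidence

end Oracle

/-! ### The causal past of a resampling -/

namespace Oracle

variable {Ω : Type*} [MeasurableSpace Ω] [StandardBorelSpace Ω] [Nonempty Ω]
  {O : ℕ → Option (NodeData Ω)}

/-- The nodes resampled in round `s` of the global process. -/
def rounds (O : ℕ → Option (NodeData Ω)) (s : ℕ) : Set ℕ :=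
  sel O (counts O (fun _ => Set.univ) s)

open Classical in
lemma counts_eq_card (O : ℕ → Option (NodeData Ω)) (s x : ℕ) :
    counts O (fun _ => Set.univ) s x =
      ((Finset.range s).filter fun s' => ∃ i ∈ rounds O s', x ∈ vars O i).card := by
  induction s with
  | zero => simp [counts]
  | succ s ih =>
    rw [Finset.range_add_one, Finset.filter_insert, counts, ih]
    by_cases h : ∃ i ∈ rounds O s, x ∈ vars O i
    · rw [if_pos h, Finset.card_insert_of_notMem (by simp), if_pos (by simpa [rounds] using h)]
    · rw [if_neg h, if_neg (by simpa [rounds] using h), add_zero]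

/-- Two adjacent selected nodes would each have to have the smaller identifier. -/
lemma IsNetwork.disjoint_of_mem_rounds (hO : IsNetwork O) {s i j x : ℕ} (hi : i ∈ rounds O s)
    (hj : j ∈ rounds O s) (hxi : x ∈ vars O i) (hxj : x ∈ vars O j) : i = j := by
  by_contra hne
  have h1 := hi.2 j (hO.adj_of_share hxi hxj hne) hj.1
  have h2 := hj.2 i (hO.adj_of_share hxj hxi (Ne.symm hne)) hi.1
  lia

lemma counts_succ_of_forall_notMem {s x : ℕ} (h : ∀ i ∈ rounds O s, x ∉ vars O i) :
    counts O (fun _ => Set.univ) (s + 1) x = counts O (fun _ => Set.univ) s x := by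
  rw [counts, if_neg, add_zero]
  rintro ⟨i, hi, hx⟩
  exact h i hi.1 hx

/-- A node that is resampled has a node within distance `2` that was resampled one round before. -/
lemma IsNetwork.exists_mem_rounds_pred (hO : IsNetwork O) {s i : ℕ} (hi : i ∈ rounds O (s + 1)) :
    ∃ j ∈ rounds O s, i ∈ cball O 2 j := by
  have change : ∀ j, ¬ (Bad O (counts O (fun _ => Set.univ) s) j ↔
      Bad O (counts O (fun _ => Set.univ) (s + 1)) j) → ∃ k ∈ rounds O s, j ∈ cball O 1 k := by
    intro j hj
    by_contra! hk
    have : ∀ x ∈ vars O j,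
        counts O (fun _ => Set.univ) (s + 1) x = counts O (fun _ => Set.univ) s x :=
      fun x hx => counts_succ_of_forall_notMem fun k hks hxk =>
        hk k hks (hO.mem_cball_of_share hxk hx)
    exact hj ⟨bad_congr fun x hx => (this x hx).symm, bad_congr this⟩
  -- Either `i` became bad through a resampling next to it, or it was selected before, or it was
  -- blocked by a bad neighbour `j` of smaller identifier. In the last case `j` is no longer bad
  -- when `i` is selected, so a resampling took place within distance 1 of `j`.
  by_cases h1 : Bad O (counts O (fun _ => Set.univ) s) i
  · by_cases h2 : i ∈ rounds O s
    · exact ⟨i, h2, self_mem_cball _ _⟩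
    · obtain ⟨j, hj, hbj, hle⟩ : ∃ j ∈ adj O i,
          Bad O (counts O (fun _ => Set.univ) s) j ∧ ¬ i < j := by
        by_contra! hcon
        exact h2 ⟨h1, hcon⟩
      have h3 : ¬ Bad O (counts O (fun _ => Set.univ) (s + 1)) j := fun hb => hle (hi.2 j hj hb)
      obtain ⟨k, hk, hjk⟩ := change j (by tauto)
      exact ⟨k, hk, cball_trans hjk (mem_cball_one.2 (Or.inr (hO.symm hj)))⟩
  · obtain ⟨k, hk, hik⟩ := change i (by have := hi.1; tauto)
    exact ⟨k, hk, cball_mono (by lia) _ hik⟩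

/-- There is a chain of `k` steps, back in time and within the region `B`, from the resampling of
`v` in round `t` to the resampling of a node `u` rounds before. -/
inductive Chain (O : ℕ → Option (NodeData Ω)) (B : Set ℕ) (t v : ℕ) : ℕ → ℕ → ℕ → Prop
  | root : Chain O B t v 0 0 v
  | step {k u u' i i' : ℕ} (h : Chain O B t v k u' i') (hu : u' < u) (ht : u ≤ t)
      (hi : i ∈ rounds O (t - u)) (hB : i ∈ B) (hball : i ∈ cball O 2 i') :
      Chain O B t v (k + 1) u i

variable {B : Set ℕ} {t v : ℕ}

lemma Chain.le {k u i : ℕ} (h : Chain O B t v k u i) : k ≤ u ∧ u ≤ t := by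
  induction h with
  | root => simp
  | step _ _ _ _ _ _ ih => lia

lemma Chain.mem {k u i : ℕ} (h : Chain O B t v k u i) (hv : v ∈ rounds O t) (hvB : v ∈ B) :
    i ∈ rounds O (t - u) ∧ i ∈ B := by
  cases h with
  | root => exact ⟨by simpa using hv, hvB⟩
  | step _ _ _ hi hB _ => exact ⟨hi, hB⟩

lemma Chain.mono {B' : Set ℕ} (hB : B ⊆ B') {k u i : ℕ} (h : Chain O B t v k u i) :
    Chain O B' t v k u i := by
  induction h with
  | root => exact .root
  | step _ hu ht hi hb hball ih => exact .step ih hu ht hi (hB hb) hball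

/-- The longest chain to the resampling has `k` steps. -/
def IsDepth (O : ℕ → Option (NodeData Ω)) (B : Set ℕ) (t v k u i : ℕ) : Prop :=
  Chain O B t v k u i ∧ ∀ k', Chain O B t v k' u i → k' ≤ k

lemma Chain.exists_isDepth {k u i : ℕ} (h : Chain O B t v k u i) :
    ∃ k', k ≤ k' ∧ IsDepth O B t v k' u i := by
  classical
  refine ⟨Nat.findGreatest (fun k => Chain O B t v k u i) u, Nat.le_findGreatest h.le.1 h,
    Nat.findGreatest_spec (P := fun k => Chain O B t v k u i) h.le.1 h, fun k' hk' =>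
    Nat.le_findGreatest hk'.le.1 hk'⟩

lemma IsDepth.unique {k k' u i : ℕ} (h : IsDepth O B t v k u i) (h' : IsDepth O B t v k' u i) :
    k = k' := le_antisymm (h'.2 _ h.1) (h.2 _ h'.1)

lemma IsDepth.lt {k k' u u' i i' : ℕ} (h' : IsDepth O B t v k' u' i')
    (hu : u' < u) (ht : u ≤ t) (hi : i ∈ rounds O (t - u)) (hB : i ∈ B)
    (hball : i ∈ cball O 2 i') (h : IsDepth O B t v k u i) : k' < k :=
  h.2 _ (.step h'.1 hu ht hi hB hball)

lemma IsDepth.pred {k u i : ℕ} (h : IsDepth O B t v (k + 1) u i) :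
    ∃ u' i', IsDepth O B t v k u' i' ∧ i ∈ cball O 2 i' := by
  obtain ⟨hc, hmax⟩ := h
  cases hc with
  | @step _ _ u' _ i' h hu ht hi hB hball =>
    refine ⟨u', i', ⟨h, fun k' hk' => ?_⟩, hball⟩
    have := hmax _ (.step hk' hu ht hi hB hball)
    lia

lemma isDepth_zero {u i : ℕ} : IsDepth O B t v 0 u i ↔ u = 0 ∧ i = v := by
  constructor
  · rintro ⟨h, -⟩
    cases h
    simp
  · rintro ⟨rfl, rfl⟩
    exact ⟨.root, fun k' hk' => hk'.le.1⟩

open Classical in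
/-- The resamplings, among the given nodes, that are reached by chains. -/
noncomputable def past (O : ℕ → Option (NodeData Ω)) (nodes : Finset ℕ) (B : Set ℕ) (t v : ℕ) :
    Finset (ℕ × ℕ) :=
  (Finset.range (t + 1) ×ˢ nodes).filter fun p => ∃ k, Chain O B t v k p.1 p.2

open Classical in
/-- The nodes at depth `k`, with a flag that tells whether they lie in `Core`. -/
noncomputable def layer (O : ℕ → Option (NodeData Ω)) (nodes : Finset ℕ) (B Core : Set ℕ)
    (t v k : ℕ) : Finset (ℕ × Bool) :=
  ((past O nodes B t v).filter fun p => IsDepth O B t v k p.1 p.2).image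
    fun p => (p.2, decide (p.2 ∈ Core))

/-- The layers from number `j` on. -/
def layersFrom (Λ : ℕ → Finset (ℕ × Bool)) : ℕ → ℕ → List (Finset (ℕ × Bool))
  | _, 0 => []
  | j, m + 1 => Λ j :: layersFrom Λ (j + 1) m

lemma length_layersFrom (Λ : ℕ → Finset (ℕ × Bool)) (j m : ℕ) :
    (layersFrom Λ j m).length = m := by
  induction m generalizing j with
  | zero => rfl
  | succ m ih => simp [layersFrom, ih]

lemma mem_layersFrom {Λ : ℕ → Finset (ℕ × Bool)} {j m : ℕ} {L : Finset (ℕ × Bool)}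
    (h : L ∈ layersFrom Λ j m) : ∃ k, L = Λ k := by
  induction m generalizing j with
  | zero => simp [layersFrom] at h
  | succ m ih =>
    rcases List.mem_cons.1 h with rfl | h
    · exact ⟨j, rfl⟩
    · exact ih h

open Classical in
omit [StandardBorelSpace Ω] [Nonempty Ω] in
lemma cnt_layersFrom (Λ : ℕ → Finset (ℕ × Bool)) (j m x : ℕ) :
    cnt O (layersFrom Λ j m) x =
      ((Finset.Ico j (j + m)).filter fun k => ∃ l ∈ Λ k, x ∈ vars O l.1).card := by
  induction m generalizing j with
  | zero => simp [layersFrom, cnt]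
  | succ m ih =>
    rw [layersFrom, cnt, ih]
    have : Finset.Ico j (j + (m + 1)) = insert j (Finset.Ico (j + 1) (j + 1 + m)) := by
      ext k; simp only [Finset.mem_insert, Finset.mem_Ico]; lia
    rw [this, Finset.filter_insert]
    split_ifs with h
    · rw [Finset.card_insert_of_notMem (by simp)]
    · rfl

lemma numLabels_layersFrom (Λ : ℕ → Finset (ℕ × Bool)) (b : Bool) (j m : ℕ) :
    numLabels b (layersFrom Λ j m) =
      ∑ k ∈ Finset.Ico j (j + m), ((Λ k).filter fun l => l.2 = b).card := by
  induction m generalizing j with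
  | zero => simp [layersFrom, numLabels]
  | succ m ih =>
    rw [Finset.sum_eq_sum_Ico_succ_bot (by lia), layersFrom]
    have := ih (j + 1)
    rw [show j + 1 + m = j + (m + 1) by lia] at this
    rw [← this]
    simp [numLabels]

omit [StandardBorelSpace Ω] [Nonempty Ω] in
lemma linked_layersFrom {Λ : ℕ → Finset (ℕ × Bool)}
    (h : ∀ k, ∀ l' ∈ Λ (k + 1), ∃ l ∈ Λ k, l'.1 ∈ cball O 2 l.1) (j m : ℕ) :
    Linked O (Λ j) (layersFrom Λ (j + 1) m) := by
  induction m generalizing j with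
  | zero => trivial
  | succ m ih => exact ⟨h j, ih (j + 1)⟩

section evidence

variable {nodes : Finset ℕ} {Core : Set ℕ}

lemma mem_layer {k : ℕ} {l : ℕ × Bool} (hl : l ∈ layer O nodes B Core t v k) :
    ∃ u, IsDepth O B t v k u l.1 ∧ u ≤ t ∧ (l.2 = true ↔ l.1 ∈ Core) := by
  classical
  obtain ⟨⟨u, i⟩, hp, rfl⟩ := Finset.mem_image.1 hl
  rw [Finset.mem_filter] at hp
  exact ⟨u, hp.2, hp.2.1.le.2, by simp⟩

variable (hO : IsNetwork O) (hnodes : ∀ i, (O i).isSome → i ∈ nodes) (hv : v ∈ rounds O t)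
  (hvB : v ∈ B)

lemma isSome_of_bad {N : ℕ → ℕ} {i : ℕ} (h : Bad O N i) : (O i).isSome := by
  obtain ⟨a, ha, -⟩ := h
  simp [ha]

include hnodes hv hvB in
lemma mem_layer_of_isDepth {k u i : ℕ} (h : IsDepth O B t v k u i) :
    ∃ l ∈ layer O nodes B Core t v k, l.1 = i := by
  classical
  refine ⟨_, Finset.mem_image.2 ⟨(u, i), ?_, rfl⟩, rfl⟩
  simp only [past, Finset.mem_filter, Finset.mem_product, Finset.mem_range]
  exact ⟨⟨⟨Nat.lt_succ_of_le h.1.le.2, hnodes i (isSome_of_bad (h.1.mem hv hvB).1.1)⟩,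
    k, h.1⟩, h⟩

-- Were one of the two earlier in time, a longest chain to the other would extend to it and put it
-- at a greater depth.
include hv hvB in
lemma IsDepth.time_eq {k u u' i i' : ℕ} (h : IsDepth O B t v k u i)
    (h' : IsDepth O B t v k u' i') (hi : i' ∈ cball O 2 i) (hi' : i ∈ cball O 2 i') : u = u' := by
  rcases lt_trichotomy u u' with hlt | heq | hlt
  · have := h.lt hlt h'.1.le.2 (h'.1.mem hv hvB).1 (h'.1.mem hv hvB).2 hi h'
    lia
  · exact heq
  · have := h'.lt hlt h.1.le.2 (h.1.mem hv hvB).1 (h.1.mem hv hvB).2 hi' h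
    lia

include hO hv hvB in
lemma IsDepth.eq_of_share {k u u' i i' x : ℕ} (h : IsDepth O B t v k u i)
    (h' : IsDepth O B t v k u' i') (hi : x ∈ vars O i) (hi' : x ∈ vars O i') : i = i' := by
  have hu := h.time_eq hv hvB h' (cball_mono (by lia) _ (hO.mem_cball_of_share hi hi'))
    (cball_mono (by lia) _ (hO.mem_cball_of_share hi' hi))
  subst hu
  exact hO.disjoint_of_mem_rounds (h.1.mem hv hvB).1 (h'.1.mem hv hvB).1 hi hi'

include hO hnodes hv hvB in
/-- The counters at the time of a resampling can be read off from the deeper layers. -/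
lemma counts_eq_cnt (hInt : ∀ i ∈ Core, cball O 1 i ⊆ B) {h j m u i x : ℕ} (ht : t ≤ h)
    (hjm : j + m = h) (hi : IsDepth O B t v j u i) (hiInt : i ∈ Core) (hx : x ∈ vars O i) :
    counts O (fun _ => Set.univ) (t - u) x =
      cnt O (layersFrom (layer O nodes B Core t v) (j + 1) m) x := by
  classical
  rw [counts_eq_card, cnt_layersFrom]
  have hiu := (hi.1.mem hv hvB).1
  have hut := hi.1.le.2
  let r : ℕ → ℕ → Prop := fun s' k => ∃ i', IsDepth O B t v k (t - s') i' ∧ x ∈ vars O i'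
  refine le_antisymm ?_ ?_
  · refine Finset.card_le_card_of_forall_subsingleton r ?_ ?_
    · intro s' hs'
      simp only [Finset.mem_filter, Finset.mem_range] at hs'
      obtain ⟨hlt, i', hi's, hxi'⟩ := hs'
      have hball := hO.mem_cball_of_share hx hxi'
      -- An earlier resampling that touches `x` extends the longest chain to `i`, so it belongs to a
      -- deeper layer. It lies in `B` because `i` is in `Core`.
      obtain ⟨k, hk, hdep⟩ := (Chain.step (u := t - s') hi.1 (by lia) (by lia)
        (by rwa [Nat.sub_sub_self (by lia)]) (hInt i hiInt hball)
        (cball_mono (by lia) _ hball)).exists_isDepth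
      refine ⟨k, ?_, i', hdep, hxi'⟩
      have := hdep.1.le
      simp only [Finset.mem_filter, Finset.mem_Ico]
      refine ⟨by lia, ?_⟩
      obtain ⟨l, hl, rfl⟩ := mem_layer_of_isDepth (Core := Core) hnodes hv hvB hdep
      exact ⟨l, hl, hxi'⟩
    · rintro k - s' ⟨hs', i', hdep', hxi'⟩ s'' ⟨hs'', i'', hdep'', hxi''⟩
      simp only [Finset.mem_filter, Finset.mem_range] at hs' hs''
      have := hdep'.time_eq hv hvB hdep''
        (cball_mono (by lia) _ (hO.mem_cball_of_share hxi' hxi''))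
        (cball_mono (by lia) _ (hO.mem_cball_of_share hxi'' hxi'))
      lia
  · refine Finset.card_le_card_of_forall_subsingleton (fun k s' => r s' k) ?_ ?_
    · intro k hk
      simp only [Finset.mem_filter, Finset.mem_Ico] at hk
      obtain ⟨hk, l, hl, hxl⟩ := hk
      obtain ⟨u', hdep, hu't, -⟩ := mem_layer hl
      have hl' := hdep.1.mem hv hvB
      -- A deeper resampling sharing `x` must be earlier: at the same time it would be `i` itself,
      -- and if it were later then `i` would be the deeper one.
      have huu' : u < u' := by
        rcases lt_trichotomy u u' with hlt | heq | hlt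
        · exact hlt
        · subst heq
          have := hO.disjoint_of_mem_rounds hiu hl'.1 hx hxl
          rw [← this] at hdep
          have := hi.unique hdep
          lia
        · have := hdep.lt hlt hut hiu (hi.1.mem hv hvB).2
            (cball_mono (by lia) _ (hO.mem_cball_of_share hxl hx)) hi
          lia
      refine ⟨t - u', ?_, l.1, by rwa [Nat.sub_sub_self hu't], hxl⟩
      simp only [Finset.mem_filter, Finset.mem_range]
      exact ⟨by lia, l.1, hl'.1, hxl⟩
    · rintro s' - k ⟨-, i', hdep', hxi'⟩ k' ⟨-, i'', hdep'', hxi''⟩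
      have := hO.disjoint_of_mem_rounds (hdep'.1.mem hv hvB).1 (hdep''.1.mem hv hvB).1 hxi' hxi''
      subst this
      exact hdep'.unique hdep''

-- A resampled node was bad with the counters of its round, and in `Core` these are the counters
-- defined by the deeper layers.
include hO hnodes hv hvB in
lemma consistent_layersFrom (hInt : ∀ i ∈ Core, cball O 1 i ⊆ B) {h j m : ℕ} (ht : t ≤ h)
    (hjm : j + m = h + 1) :
    Consistent O (layersFrom (layer O nodes B Core t v) j m) := by
  induction m generalizing j with
  | zero => trivial
  | succ m ih =>
    refine ⟨fun l hl hl2 => ?_, ih (by lia)⟩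
    obtain ⟨u, hdep, -, hflag⟩ := mem_layer hl
    refine bad_congr (fun x hx => ?_) (hdep.1.mem hv hvB).1.1
    exact counts_eq_cnt hO hnodes hv hvB hInt ht (by lia) hdep (hflag.1 hl2) hx

-- At a given depth a node occurs at one time only, so forgetting the times in `layer` loses no
-- member of the past.
open Classical in
include hv hvB in
lemma card_layer_filter (b : Bool) (k : ℕ) :
    ((layer O nodes B Core t v k).filter fun l => l.2 = b).card =
      (((past O nodes B t v).filter fun p => decide (p.2 ∈ Core) = b).filter
        fun p => IsDepth O B t v k p.1 p.2).card := by
  rw [layer, Finset.filter_image, Finset.card_image_of_injOn]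
  · congr 1
    ext p
    simp only [Finset.mem_filter]
    tauto
  · rintro ⟨u, i⟩ hp ⟨u', i'⟩ hp' heq
    simp only [Finset.coe_filter, Finset.mem_filter, Set.mem_ofPred_eq] at hp hp'
    simp only [Prod.mk.injEq] at heq
    obtain ⟨rfl, -⟩ := heq
    have := hp.1.2.time_eq hv hvB hp'.1.2 (self_mem_cball _ _) (self_mem_cball _ _)
    rw [this]

-- Each member of the past has exactly one depth, and it is at most `t`; the layers partition the
-- past.
open Classical in
include hv hvB in
lemma numLabels_layers (b : Bool) {h : ℕ} (ht : t ≤ h) :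
    numLabels b (layersFrom (layer O nodes B Core t v) 0 (h + 1)) =
      ((past O nodes B t v).filter fun p => decide (p.2 ∈ Core) = b).card := by
  rw [numLabels_layersFrom]
  simp only [card_layer_filter hv hvB]
  rw [← Finset.card_biUnion]
  · congr 1
    ext p
    simp only [Finset.mem_biUnion, Finset.mem_filter, Finset.mem_Ico]
    constructor
    · rintro ⟨k, -, h, -⟩
      exact h
    · intro hp
      obtain ⟨k, hk⟩ := (Finset.mem_filter.1 hp.1).2
      obtain ⟨k', -, hk'⟩ := hk.exists_isDepth
      have := hk'.1.le
      exact ⟨k', by lia, hp, hk'⟩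
  · rintro k - k' - hne
    rw [Function.onFun, Finset.disjoint_left]
    intro p hp hp'
    exact hne ((Finset.mem_filter.1 hp).2.unique (Finset.mem_filter.1 hp').2)

open Classical in
include hO hnodes hv hvB in
/-- The causal past of a resampling inside a region gives evidence. -/
lemma evidence_of_past (hInt : ∀ i ∈ Core, cball O 1 i ⊆ B) (hvInt : v ∈ Core) {R : Set ℕ}
    (hBR : B ⊆ R) {h S : ℕ} (ht : t ≤ h)
    (hhalf : (past O nodes B t v).card ≤ 2 * ((past O nodes B t v).filter (·.2 ∈ Core)).card)
    (hS : S ≤ ((past O nodes B t v).filter (·.2 ∈ Core)).card) : Evidence O v h S R := by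
  have hroot : layer O nodes B Core t v 0 = {(v, true)} := by
    ext ⟨i, b⟩
    rw [Finset.mem_singleton]
    constructor
    · intro hl
      obtain ⟨u, hdep, -, hflag⟩ := mem_layer hl
      obtain ⟨-, h⟩ := isDepth_zero.1 hdep
      simp only at h hflag
      subst h
      rw [Prod.mk.injEq]
      exact ⟨rfl, hflag.2 hvInt⟩
    · intro h
      obtain ⟨l, hl, hlv⟩ := mem_layer_of_isDepth (Core := Core) hnodes hv hvB
        (isDepth_zero.2 ⟨rfl, rfl⟩)
      obtain ⟨u, hdep, -, hflag⟩ := mem_layer hl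
      have : l = (v, true) := Prod.ext hlv (hflag.2 (hlv ▸ hvInt))
      rwa [h, ← this]
  have hcons : ({(v, true)} : Finset (ℕ × Bool)) ::
      layersFrom (layer O nodes B Core t v) 1 h =
      layersFrom (layer O nodes B Core t v) 0 (h + 1) := by
    rw [layersFrom, hroot]
  have htrue : numLabels true (layersFrom (layer O nodes B Core t v) 0 (h + 1)) =
      ((past O nodes B t v).filter (·.2 ∈ Core)).card := by
    rw [numLabels_layers hv hvB _ ht]; simp
  have hfalse : numLabels false (layersFrom (layer O nodes B Core t v) 0 (h + 1)) =
      ((past O nodes B t v).filter (¬ ·.2 ∈ Core)).card := by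
    rw [numLabels_layers hv hvB _ ht]; simp
  refine ⟨layersFrom (layer O nodes B Core t v) 1 h, length_layersFrom _ _ _, ?_, ?_, ?_, ?_, ?_⟩
  · rw [← hroot]
    refine linked_layersFrom (fun k l' hl' => ?_) 0 h
    obtain ⟨u, hdep, -, -⟩ := mem_layer hl'
    obtain ⟨u', i', hdep', hball⟩ := hdep.pred
    obtain ⟨l, hl, rfl⟩ := mem_layer_of_isDepth (Core := Core) hnodes hv hvB hdep'
    exact ⟨l, hl, hball⟩
  · rw [hcons]
    intro L hL
    obtain ⟨k, rfl⟩ := mem_layersFrom hL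
    refine ⟨fun l hl => ?_, fun l hl l' hl' hne => ?_⟩
    · obtain ⟨u, hdep, -, -⟩ := mem_layer hl
      have := hdep.1.mem hv hvB
      exact ⟨isSome_of_bad this.1.1, hBR this.2⟩
    · obtain ⟨u, hdep, -, hflag⟩ := mem_layer hl
      obtain ⟨u', hdep', -, hflag'⟩ := mem_layer hl'
      rw [Set.disjoint_left]
      intro x hx hx'
      have := hdep.eq_of_share hO hv hvB hdep' hx hx'
      refine hne (Prod.ext this ?_)
      rw [this] at hflag
      exact Bool.eq_iff_iff.2 (hflag.trans hflag'.symm)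
  · rw [hcons]
    exact consistent_layersFrom hO hnodes hv hvB hInt ht (by lia)
  · rw [hcons, htrue, hfalse]
    have := Finset.card_filter_add_card_filter_not (s := past O nodes B t v) (·.2 ∈ Core)
    lia
  · rw [hcons, htrue]
    exact hS

end evidence

lemma past_mono {nodes : Finset ℕ} {B B' : Set ℕ} (h : B ⊆ B') :
    past O nodes B t v ⊆ past O nodes B' t v := by
  classical
  intro p hp
  simp only [past, Finset.mem_filter] at hp ⊢
  obtain ⟨h1, k, hk⟩ := hp
  exact ⟨h1, k, hk.mono h⟩

/-- `exists_mem_rounds_pred` is iterated: each round back in time costs distance at most 2. -/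
lemma IsNetwork.exists_chain (hO : IsNetwork O) (hv : v ∈ rounds O t) {r : ℕ} (hr : r ≤ t)
    (hB : cball O (2 * r) v ⊆ B) :
    ∃ i ∈ rounds O (t - r), i ∈ cball O (2 * r) v ∧ Chain O B t v r r i := by
  induction r with
  | zero => exact ⟨v, by simpa using hv, rfl, .root⟩
  | succ r ih =>
    obtain ⟨i', hi', hball, hch⟩ := ih (by lia) ((cball_mono (by lia) v).trans hB)
    rw [show t - r = t - (r + 1) + 1 by lia] at hi'
    obtain ⟨i, hi, hi'i⟩ := hO.exists_mem_rounds_pred hi'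
    have h2 := hO.mem_cball_symm hi'i
    have h3 : i ∈ cball O (2 * (r + 1)) v := cball_trans hball h2
    exact ⟨i, hi, h3, .step hch (by lia) hr hi (hB h3) h2⟩

-- The chains of `exists_chain` supply one member for each delay `0, …, r`.
open Classical in
lemma IsNetwork.lt_card_past (hO : IsNetwork O) {nodes : Finset ℕ}
    (hnodes : ∀ i, (O i).isSome → i ∈ nodes) (hv : v ∈ rounds O t) {r : ℕ} (hr : r ≤ t)
    (hB : cball O (2 * r) v ⊆ B) {Core : Set ℕ} (hInt : cball O (2 * r) v ⊆ Core) :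
    r + 1 ≤ ((past O nodes B t v).filter (·.2 ∈ Core)).card := by
  rw [← Finset.card_range (r + 1)]
  refine Finset.card_le_card_of_surjOn Prod.fst fun u hu => ?_
  have hu' : u ≤ r := Nat.lt_succ_iff.1 (Finset.mem_range.1 hu)
  obtain ⟨i, hi, hball, hch⟩ := hO.exists_chain hv (hu'.trans hr)
    ((cball_mono (by lia) v).trans hB)
  refine ⟨(u, i), ?_, rfl⟩
  simp only [past, Finset.coe_filter, Finset.mem_filter, Finset.mem_product, Finset.mem_range,
    Set.mem_ofPred_eq]
  exact ⟨⟨⟨by lia, hnodes i (isSome_of_bad hi.1)⟩, u, hch⟩,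
    hInt (cball_mono (by lia) v hball)⟩

/-- With the whole graph as region and core, every member of the past is tested. -/
lemma IsNetwork.evidence_of_card_le (hO : IsNetwork O) {nodes : Finset ℕ}
    (hnodes : ∀ i, (O i).isSome → i ∈ nodes) (hv : v ∈ rounds O t) {h K : ℕ} (ht : t ≤ h)
    (hK : K ≤ (past O nodes B t v).card) : Evidence O v h K Set.univ := by
  classical
  have h1 : (past O nodes B t v).card ≤ (past O nodes Set.univ t v).card :=
    Finset.card_le_card (past_mono (Set.subset_univ _))
  refine evidence_of_past (Core := Set.univ) (B := Set.univ) hO hnodes hv (Set.mem_univ _)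
    (fun _ _ => Set.subset_univ _) (Set.mem_univ _) subset_rfl ht ?_ ?_
  · simp; lia
  · simp; lia

lemma IsNetwork.evidence_of_long (hO : IsNetwork O) {nodes : Finset ℕ}
    (hnodes : ∀ i, (O i).isSome → i ∈ nodes) (hv : v ∈ rounds O t) {h K : ℕ} (ht : t ≤ h)
    (hK : K ≤ t + 1) : Evidence O v h K Set.univ := by
  classical
  refine hO.evidence_of_card_le (B := Set.univ) hnodes hv ht (hK.trans ?_)
  refine (hO.lt_card_past hnodes hv le_rfl (Set.subset_univ _) (Core := Set.univ)
    (Set.subset_univ _)).trans ?_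
  simp

/-- A late resampling has evidence close by, unless there is a lot of evidence somewhere. -/
lemma IsNetwork.evidence_of_late (hO : IsNetwork O) {nodes : Finset ℕ}
    (hnodes : ∀ i, (O i).isSome → i ∈ nodes) (hv : v ∈ rounds O t) {h K τ : ℕ} (ht : t ≤ h)
    (hτ : 4 * τ ≤ t) (hK : K ≤ 2 ^ τ) :
    Evidence O v h K Set.univ ∨ Evidence O v h (4 * τ) (cball O (10 * τ) v) := by
  classical
  -- The past is cut off at radius `2r + 2`; `f r` counts the members within radius `2r`, whose
  -- neighbourhoods lie inside the cut-off region.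
  let P : ℕ → Finset (ℕ × ℕ) := fun r => past O nodes (cball O (2 * r + 2) v) t v
  let f : ℕ → ℕ := fun r => ((P r).filter (·.2 ∈ cball O (2 * r) v)).card
  have hstep : ∀ r, (P r).card ≤ f (r + 1) := by
    intro r
    refine Finset.card_le_card fun p hp => Finset.mem_filter.2 ⟨?_, ?_⟩
    · exact past_mono (cball_mono (by lia) v) hp
    · obtain ⟨k, hk⟩ := (Finset.mem_filter.1 hp).2
      exact (hk.mem hv (self_mem_cball _ _)).2
  have hlow : ∀ r ≤ t, r + 1 ≤ f r := fun r hr =>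
    hO.lt_card_past hnodes hv hr (cball_mono (by lia) v) subset_rfl
  -- The window holds `τ` radii. Its lower end guarantees `4τ` tested nodes, and its upper end keeps
  -- `2r + 2` below `10τ`.
  by_cases hgood : ∃ r, 4 * τ ≤ r + 1 ∧ r + 1 < 5 * τ ∧ (P r).card ≤ 2 * f r
  · right
    obtain ⟨r, h1, h2, h3⟩ := hgood
    refine evidence_of_past hO hnodes hv (self_mem_cball _ _)
      (fun i hi j hj => cball_mono (by lia) v (cball_trans hi hj))
      (self_mem_cball (2 * r) v) (cball_mono (by lia) v) ht h3 ?_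
    have hmono : 4 * τ ≤ f r := by
      by_cases hrt : r ≤ t
      · exact h1.trans (hlow r hrt)
      · refine hτ.trans ((Nat.le_succ t).trans ?_)
        exact hO.lt_card_past hnodes hv le_rfl (cball_mono (by lia) v) (cball_mono (by lia) v)
    exact hmono
  · left
    push Not at hgood
    rcases Nat.eq_zero_or_pos τ with rfl | hpos
    · refine hO.evidence_of_long hnodes hv ht (hK.trans ?_)
      simp
    · have h2 : 4 * τ ≤ f (4 * τ - 1) := by
        have := hlow (4 * τ - 1) (by lia)
        lia
      -- Without a good radius `f` doubles at each step of the window, starting from at least 2.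
      have h3 : 2 * 2 ^ (τ - 1) ≤ f (4 * τ - 1 + (τ - 1)) := by
        have : ∀ m, m < τ → 2 * 2 ^ m ≤ f (4 * τ - 1 + m) := by
          intro m
          induction m with
          | zero => intro hm; simp only [add_zero, pow_zero, mul_one]; lia
          | succ m ih =>
            intro hm
            have h1 := ih (by lia)
            have h2 := hgood (4 * τ - 1 + m) (by lia) (by lia)
            have h3 := hstep (4 * τ - 1 + m)
            rw [pow_succ, show 4 * τ - 1 + (m + 1) = 4 * τ - 1 + m + 1 by lia]
            lia
        exact this (τ - 1) (by lia)
      have h4 : 2 ^ τ ≤ (P (4 * τ - 1 + (τ - 1))).card := by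
        refine le_trans (le_of_eq ?_) (h3.trans (Finset.card_filter_le _ _))
        rw [← pow_succ', Nat.sub_add_cancel hpos]
      exact hO.evidence_of_card_le hnodes hv ht (hK.trans h4)

end Oracle

/-! ### A generating function for layer sequences -/

section layerSeqs

variable {α : Type*} [DecidableEq α]

/-- The sequences of `h` finite sets, each contained in the neighbourhood of the previous one, the
first one in the neighbourhood of `L`. -/
def layerSeqs (N : α → Finset α) : ℕ → Finset α → Finset (List (Finset α))
  | 0, _ => {[]}
  | h + 1, L => (L.biUnion N).powerset.biUnion fun L' => (layerSeqs N h L').image (L' :: ·)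

/-- Each node of the next layer pays `q` and, by induction, at most `F` for the layers below.
Summing over subsets of the neighbourhood gives `(q * F + 1) ^ (Δ * L.card)` by the binomial
theorem, and `hF` closes the induction with a bound that does not depend on `h`. -/
lemma sum_layerSeqs_le (N : α → Finset α) {Δ : ℕ} (hN : ∀ i, (N i).card ≤ Δ) {q F : ENNReal}
    (hF1 : 1 ≤ F) (hF : (q * F + 1) ^ Δ ≤ F) (h : ℕ) (L : Finset α) :
    ∑ Λ ∈ layerSeqs N h L, q ^ (Λ.map Finset.card).sum ≤ F ^ L.card := by
  induction h generalizing L with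
  | zero => simpa [layerSeqs] using one_le_pow₀ hF1
  | succ h ih =>
    calc ∑ Λ ∈ layerSeqs N (h + 1) L, q ^ (Λ.map Finset.card).sum
        ≤ ∑ L' ∈ (L.biUnion N).powerset, ∑ Λ ∈ (layerSeqs N h L').image (L' :: ·),
            q ^ (Λ.map Finset.card).sum := by
          refine (Finset.sum_biUnion fun L₁ _ L₂ _ hne => ?_).le
          rw [Function.onFun, Finset.disjoint_left]
          intro Λ h₁ h₂
          obtain ⟨Λ₁, -, rfl⟩ := Finset.mem_image.1 h₁
          obtain ⟨Λ₂, -, heq⟩ := Finset.mem_image.1 h₂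
          exact hne (List.cons.inj heq).1.symm
      _ ≤ ∑ L' ∈ (L.biUnion N).powerset,
            q ^ L'.card * ∑ Λ ∈ layerSeqs N h L', q ^ (Λ.map Finset.card).sum := by
          refine Finset.sum_le_sum fun L' _ => ?_
          rw [Finset.sum_image fun _ _ _ _ h => (List.cons.inj h).2, Finset.mul_sum]
          simp [pow_add]
      _ ≤ ∑ L' ∈ (L.biUnion N).powerset, (q * F) ^ L'.card := by
          refine Finset.sum_le_sum fun L' _ => ?_
          rw [mul_pow]
          gcongr
          exact ih L'
      _ = (q * F + 1) ^ (L.biUnion N).card := by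
          rw [← Finset.sum_pow_mul_eq_add_pow]
          simp
      _ ≤ (q * F + 1) ^ (Δ * L.card) := by
          refine pow_le_pow_right₀ (by simp) ?_
          rw [mul_comm]
          exact Finset.card_biUnion_le_card_mul _ _ _ fun i _ => hN i
      _ ≤ F ^ L.card := by
          rw [pow_mul]
          gcongr

end layerSeqs

/-! ### The probability of evidence -/

namespace LLLInstance

variable {Ω : Type*} [MeasurableSpace Ω] {n : ℕ} (I : LLLInstance Ω n)

lemma volumeOracle_id (r : Fin n → ℕ → Bool) (v : Fin n) :
    I.volumeOracle r (I.id v) = some (I.info v, r v) := by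
  have h : ∃ w, I.id w = I.id v := ⟨v, rfl⟩
  unfold volumeOracle oracle
  rw [dif_pos h, I.id_injective h.choose_spec]

lemma volumeOracle_eq_some {r : Fin n → ℕ → Bool} {i : ℕ} {a : NodeData Ω} :
    I.volumeOracle r i = some a ↔ ∃ v, I.id v = i ∧ (I.info v, r v) = a := by
  constructor
  · intro h
    by_cases hv : ∃ v, I.id v = i
    · obtain ⟨v, rfl⟩ := hv
      rw [volumeOracle_id] at h
      exact ⟨v, rfl, Option.some.inj h⟩
    · simp [volumeOracle, oracle, hv] at h
  · rintro ⟨v, rfl, rfl⟩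
    exact I.volumeOracle_id r v

/-- The oracle when all random bits are zero, which has all of the structure of the input. -/
noncomputable def baseOracle : ℕ → Option (NodeData Ω) := I.volumeOracle fun _ _ => false

variable (r : Fin n → ℕ → Bool)

lemma isSome_volumeOracle {i : ℕ} : (I.volumeOracle r i).isSome ↔ ∃ v, I.id v = i := by
  rw [Option.isSome_iff_exists]
  simp only [volumeOracle_eq_some]
  constructor
  · rintro ⟨a, v, h, -⟩; exact ⟨v, h⟩
  · rintro ⟨v, h⟩; exact ⟨_, v, h, rfl⟩

lemma isSome_volumeOracle_eq (i : ℕ) :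
    (I.volumeOracle r i).isSome = (I.baseOracle i).isSome :=
  Bool.eq_iff_iff.2 ((I.isSome_volumeOracle r).trans (I.isSome_volumeOracle _).symm)

lemma vars_volumeOracle (v : Fin n) : Oracle.vars (I.volumeOracle r) (I.id v) = I.vbl v := by
  ext x
  simp only [Oracle.vars, volumeOracle_id, Option.some.injEq, exists_eq_left', Set.mem_ofPred_eq]
  rfl

lemma adj_volumeOracle (v : Fin n) :
    Oracle.adj (I.volumeOracle r) (I.id v) = I.id '' I.depGraph.neighborSet v := by
  ext x
  simp only [Oracle.adj, volumeOracle_id, Option.some.injEq, exists_eq_left', Set.mem_ofPred_eq]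
  rfl

lemma exists_id_of_mem_vars {i x : ℕ} (h : x ∈ Oracle.vars (I.volumeOracle r) i) :
    ∃ v, I.id v = i ∧ x ∈ I.vbl v := by
  obtain ⟨a, ha, hx⟩ := h
  obtain ⟨v, rfl, rfl⟩ := I.volumeOracle_eq_some.1 ha
  exact ⟨v, rfl, hx⟩

lemma exists_id_of_mem_adj {i j : ℕ} (h : j ∈ Oracle.adj (I.volumeOracle r) i) :
    ∃ v w, I.id v = i ∧ I.id w = j ∧ I.depGraph.Adj v w := by
  obtain ⟨a, ha, hj⟩ := h
  obtain ⟨v, rfl, rfl⟩ := I.volumeOracle_eq_some.1 ha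
  obtain ⟨w, hw, rfl⟩ := hj
  exact ⟨v, w, rfl, rfl, hw⟩

lemma vars_volumeOracle_eq : Oracle.vars (I.volumeOracle r) = Oracle.vars I.baseOracle := by
  funext i
  ext x
  constructor <;> intro h <;> obtain ⟨v, rfl, hx⟩ := I.exists_id_of_mem_vars _ h
  · rwa [baseOracle, vars_volumeOracle]
  · rwa [vars_volumeOracle]

lemma adj_volumeOracle_eq : Oracle.adj (I.volumeOracle r) = Oracle.adj I.baseOracle := by
  funext i
  ext x
  constructor <;> intro h <;> obtain ⟨v, w, rfl, rfl, hx⟩ := I.exists_id_of_mem_adj _ h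
  · rw [baseOracle, adj_volumeOracle]; exact ⟨w, hx, rfl⟩
  · rw [adj_volumeOracle]; exact ⟨w, hx, rfl⟩

lemma cball_volumeOracle_eq (m w : ℕ) :
    Oracle.cball (I.volumeOracle r) m w = Oracle.cball I.baseOracle m w := by
  induction m with
  | zero => rfl
  | succ m ih => simp only [Oracle.cball, ih, adj_volumeOracle_eq]

lemma isNetwork_volumeOracle : Oracle.IsNetwork (I.volumeOracle r) where
  adj_of_share := by
    intro i j x hi hj hne
    obtain ⟨v, rfl, hv⟩ := I.exists_id_of_mem_vars r hi
    obtain ⟨w, rfl, hw⟩ := I.exists_id_of_mem_vars r hj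
    rw [adj_volumeOracle]
    exact ⟨w, ⟨fun h => hne (by rw [h]), x, hv, hw⟩, rfl⟩
  symm := by
    intro i j h
    obtain ⟨v, w, rfl, rfl, hadj⟩ := I.exists_id_of_mem_adj r h
    rw [adj_volumeOracle]
    exact ⟨v, hadj.symm, rfl⟩
  irrefl := by
    intro i h
    obtain ⟨v, w, rfl, h', hadj⟩ := I.exists_id_of_mem_adj r h
    exact hadj.ne (I.id_injective h').symm

lemma finite_adj (i : ℕ) : (Oracle.adj I.baseOracle i).Finite :=
  (Set.finite_range I.id).subset fun j hj => by
    obtain ⟨v, w, -, rfl, -⟩ := I.exists_id_of_mem_adj _ hj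
    exact ⟨w, rfl⟩

lemma finite_cball (m i : ℕ) : (Oracle.cball I.baseOracle m i).Finite := by
  induction m with
  | zero => exact Set.finite_singleton i
  | succ m ih =>
    refine ih.union ((ih.biUnion fun u _ => I.finite_adj u).subset ?_)
    rintro j ⟨u, hu, hj⟩
    exact Set.mem_biUnion hu hj

/-- The closed ball as a finite set. -/
noncomputable def ball (m i : ℕ) : Finset ℕ := (I.finite_cball m i).toFinset

lemma mem_ball {m i j : ℕ} : j ∈ I.ball m i ↔ j ∈ Oracle.cball I.baseOracle m i := by
  simp [ball]

variable {I} in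
lemma HasParams.card_ball_le {κ d : ℕ} {p : ℝ} (hI : I.HasParams κ d p) (m i : ℕ) :
    (I.ball m i).card ≤ (d + 1) ^ m := by
  classical
  have hadj : ∀ u, (I.finite_adj u).toFinset.card ≤ d := by
    intro u
    by_cases hu : ∃ v, I.id v = u
    · obtain ⟨v, rfl⟩ := hu
      rw [← Set.ncard_eq_toFinset_card _ (I.finite_adj _), baseOracle, adj_volumeOracle]
      exact (Set.ncard_image_le (Set.toFinite _)).trans (hI.2.1 v)
    · rw [Finset.card_eq_zero.2]
      · exact Nat.zero_le _
      · rw [Set.Finite.toFinset_eq_empty]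
        ext j
        simp only [Set.mem_empty_iff_false, iff_false]
        intro hj
        obtain ⟨v, w, rfl, -⟩ := I.exists_id_of_mem_adj _ hj
        exact hu ⟨v, rfl⟩
  induction m with
  | zero =>
    have : I.ball 0 i = {i} := by ext j; rw [mem_ball, Finset.mem_singleton]; rfl
    simp [this]
  | succ m ih =>
    have hsub : I.ball (m + 1) i ⊆
        I.ball m i ∪ (I.ball m i).biUnion fun u => (I.finite_adj u).toFinset := by
      intro j hj
      rw [mem_ball] at hj
      rw [Finset.mem_union, Finset.mem_biUnion]
      rcases hj with hj | ⟨u, hu, hj⟩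
      · exact Or.inl (I.mem_ball.2 hj)
      · exact Or.inr ⟨u, I.mem_ball.2 hu, by simpa using hj⟩
    calc (I.ball (m + 1) i).card
        ≤ (I.ball m i).card + (I.ball m i).card * d :=
          (Finset.card_le_card hsub).trans ((Finset.card_union_le _ _).trans
            (Nat.add_le_add_left (Finset.card_biUnion_le_card_mul _ _ _ fun u _ => hadj u) _))
      _ = (I.ball m i).card * (d + 1) := by ring
      _ ≤ (d + 1) ^ (m + 1) := by rw [pow_succ]; gcongr

section events

variable [StandardBorelSpace Ω] [Nonempty Ω] [Nonempty (Fin n)]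

open Classical in
/-- The event of smallest identifier that depends on the variable `x`. -/
noncomputable def owner (x : ℕ) : Fin n :=
  if h : ((Finset.univ : Finset (Fin n)).filter fun v => x ∈ I.vbl v).Nonempty then
    (Finset.exists_min_image _ I.id h).choose
  else Classical.arbitrary _

omit [StandardBorelSpace Ω] [Nonempty Ω] in
lemma owner_spec {x : ℕ} {v : Fin n} (hx : x ∈ I.vbl v) :
    x ∈ I.vbl (I.owner x) ∧ ∀ w, x ∈ I.vbl w → I.id (I.owner x) ≤ I.id w := by
  classical
  have h : ((Finset.univ : Finset (Fin n)).filter fun v => x ∈ I.vbl v).Nonempty :=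
    ⟨v, by simp [hx]⟩
  have := (Finset.exists_min_image _ I.id h).choose_spec
  rw [owner, dif_pos h]
  simp only [Finset.mem_filter, Finset.mem_univ, true_and] at this ⊢
  exact this

/-- The probability space of the private random bits. -/
noncomputable abbrev bitMeasure (n : ℕ) : Measure (Fin n → ℕ → Bool) :=
  Measure.pi fun _ : Fin n => randomBits

/-- The sigma-algebra generated by the samples with index in `S`. -/
@[reducible]
noncomputable def sampleAlgebra (S : Set (ℕ × ℕ)) : MeasurableSpace (Fin n → ℕ → Bool) :=
  tableAlgebra I.law I.owner S

/-- Both sides read the bits of the node of smallest identifier depending on `x`. This ties the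
process seen by probes to the table of independent samples. -/
lemma tab_volumeOracle {x k : ℕ} {v : Fin n} (hx : x ∈ I.vbl v) :
    Oracle.tab (I.volumeOracle r) x k = sampleTable I.law I.owner (x, k) r := by
  obtain ⟨h1, h2⟩ := I.owner_spec hx
  rw [Oracle.tab_eq (I.volumeOracle_id r (I.owner x)) h1]
  · have h1' : x ∈ (I.info (I.owner x)).vars := h1
    rw [Oracle.nodeSample, dif_pos h1']
    rfl
  · intro j hj hxj
    obtain ⟨w, rfl, hw⟩ := I.exists_id_of_mem_vars r hxj
    have := h2 w hw
    lia

lemma bad_volumeOracle_iff (N : ℕ → ℕ) (v : Fin n) :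
    Oracle.Bad (I.volumeOracle r) N (I.id v) ↔
      r ∈ sampleEvent I.law I.owner (I.vbl v) (I.bad v) N := by
  have htab : (fun x : I.vbl v => Oracle.tab (I.volumeOracle r) x (N x)) =
      fun x : I.vbl v => sampleTable I.law I.owner (x, N x) r :=
    funext fun x => I.tab_volumeOracle r x.2
  constructor
  · rintro ⟨a, ha, -, hb⟩
    rw [volumeOracle_id] at ha
    obtain rfl := Option.some.inj ha
    change (fun x : I.vbl v => Oracle.tab (I.volumeOracle r) x (N x)) ∈ I.bad v at hb
    rwa [htab] at hb
  · intro hb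
    refine ⟨_, I.volumeOracle_id r v, ?_, ?_⟩
    · rintro j ⟨w, -, rfl⟩
      rw [volumeOracle_id]; rfl
    · change (fun x : I.vbl v => Oracle.tab (I.volumeOracle r) x (N x)) ∈ I.bad v
      rw [htab]
      exact hb

lemma setOf_bad_eq (N : ℕ → ℕ) (i : ℕ) :
    (∃ v, I.id v = i ∧ {r | Oracle.Bad (I.volumeOracle r) N i} =
      sampleEvent I.law I.owner (I.vbl v) (I.bad v) N) ∨
    {r | Oracle.Bad (I.volumeOracle r) N i} = ∅ := by
  by_cases h : ∃ v, I.id v = i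
  · obtain ⟨v, rfl⟩ := h
    exact Or.inl ⟨v, rfl, Set.ext fun r => I.bad_volumeOracle_iff r N v⟩
  · right
    ext r
    simp only [Set.mem_ofPred_eq, Set.mem_empty_iff_false, iff_false]
    intro hb
    exact h ((I.isSome_volumeOracle r).1 (Oracle.isSome_of_bad hb))

lemma measurableSet_bad_event (N : ℕ → ℕ) (i : ℕ) :
    MeasurableSet[I.sampleAlgebra {c | c.1 ∈ Oracle.vars I.baseOracle i ∧ c.2 = N c.1}]
      {r | Oracle.Bad (I.volumeOracle r) N i} := by
  rcases I.setOf_bad_eq N i with ⟨v, rfl, h⟩ | h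
  · rw [h, baseOracle, vars_volumeOracle]
    exact measurableSet_sampleEvent I.law I.owner (I.measurableSet_bad v) N
  · rw [h]
    exact @MeasurableSet.empty _ (_)

variable {I} in
lemma HasParams.measure_bad_event_le {κ d : ℕ} {p : ℝ} (hI : I.HasParams κ d p) (N : ℕ → ℕ)
    (i : ℕ) : bitMeasure n {r | Oracle.Bad (I.volumeOracle r) N i} ≤ ENNReal.ofReal p := by
  rcases I.setOf_bad_eq N i with ⟨v, rfl, h⟩ | h
  · rw [h, measure_sampleEvent I.law I.owner (I.measurableSet_bad v)]
    exact hI.2.2 v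
  · simp [h]

lemma measure_inter_le {S T : Set (ℕ × ℕ)} (hST : Disjoint S T) {A B : Set (Fin n → ℕ → Bool)}
    (hA : MeasurableSet[I.sampleAlgebra S] A) (hB : MeasurableSet[I.sampleAlgebra T] B)
    {a b : ENNReal} (ha : bitMeasure n A ≤ a) (hb : bitMeasure n B ≤ b) :
    bitMeasure n (A ∩ B) ≤ a * b := by
  rw [(Indep_iff _ _ _).1 (indep_tableAlgebra I.law I.owner hST) A B hA hB]
  gcongr

variable {I} in
/-- Bad events without common variables are independent. -/
lemma HasParams.measure_layer_le {κ d : ℕ} {p : ℝ} (hI : I.HasParams κ d p) (N : ℕ → ℕ)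
    (L : Finset (ℕ × Bool)) (hL : ∀ l ∈ L, ∀ l' ∈ L, l ≠ l' →
      Disjoint (Oracle.vars I.baseOracle l.1) (Oracle.vars I.baseOracle l'.1)) :
    MeasurableSet[I.sampleAlgebra
        {c | (∃ l ∈ L, c.1 ∈ Oracle.vars I.baseOracle l.1) ∧ c.2 = N c.1}]
      {r | ∀ l ∈ L, Oracle.Bad (I.volumeOracle r) N l.1} ∧
    bitMeasure n {r | ∀ l ∈ L, Oracle.Bad (I.volumeOracle r) N l.1} ≤
      ENNReal.ofReal p ^ L.card := by
  classical
  induction L using Finset.induction_on with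
  | empty => simp
  | insert l L hl ih =>
    obtain ⟨ih1, ih2⟩ := ih fun l hl l' hl' => hL l (by simp [hl]) l' (by simp [hl'])
    have heq : {r | ∀ l' ∈ insert l L, Oracle.Bad (I.volumeOracle r) N l'.1} =
        {r | Oracle.Bad (I.volumeOracle r) N l.1} ∩
          {r | ∀ l ∈ L, Oracle.Bad (I.volumeOracle r) N l.1} := by
      ext r
      simp only [Set.mem_ofPred_eq, Set.mem_inter_iff, Finset.forall_mem_insert]
    rw [heq]
    constructor
    · refine MeasurableSet.inter ?_ ?_
      · refine tableAlgebra_mono I.law I.owner ?_ _ (I.measurableSet_bad_event N l.1)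
        rintro c ⟨h1, h2⟩
        exact ⟨⟨l, by simp, h1⟩, h2⟩
      · refine tableAlgebra_mono I.law I.owner ?_ _ ih1
        rintro c ⟨⟨l', hl', h1⟩, h2⟩
        exact ⟨⟨l', by simp [hl'], h1⟩, h2⟩
    · rw [Finset.card_insert_of_notMem hl, pow_succ']
      refine I.measure_inter_le ?_ (I.measurableSet_bad_event N l.1) ih1
        (hI.measure_bad_event_le N l.1) ih2
      rw [Set.disjoint_left]
      rintro c ⟨h1, -⟩ ⟨⟨l', hl', h2⟩, -⟩
      exact Set.disjoint_left.1 (hL l (by simp) l' (by simp [hl'])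
        (by rintro rfl; exact hl hl')) h1 h2

omit [StandardBorelSpace Ω] [Nonempty Ω] [Nonempty (Fin n)] in
lemma cnt_volumeOracle_eq (Ls : List (Finset (ℕ × Bool))) :
    Oracle.cnt (I.volumeOracle r) Ls = Oracle.cnt I.baseOracle Ls := by
  induction Ls with
  | nil => rfl
  | cons L Ls ih =>
    funext x
    rw [Oracle.cnt, Oracle.cnt, ih, vars_volumeOracle_eq]

variable {I} in
/-- The probability that layers are consistent with the samples. -/
lemma HasParams.measure_consistent_le {κ d : ℕ} {p : ℝ} (hI : I.HasParams κ d p)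
    (Ls : List (Finset (ℕ × Bool))) (hLs : ∀ L ∈ Ls, ∀ l ∈ L, ∀ l' ∈ L, l ≠ l' →
      Disjoint (Oracle.vars I.baseOracle l.1) (Oracle.vars I.baseOracle l'.1)) :
    MeasurableSet[I.sampleAlgebra {c | c.2 < Oracle.cnt I.baseOracle Ls c.1}]
      {r | Oracle.Consistent (I.volumeOracle r) Ls} ∧
    bitMeasure n {r | Oracle.Consistent (I.volumeOracle r) Ls} ≤
      ENNReal.ofReal p ^ Oracle.numLabels true Ls := by
  classical
  induction Ls with
  | nil => simp [Oracle.Consistent, Oracle.numLabels]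
  | cons L Ls ih =>
    obtain ⟨ih1, ih2⟩ := ih fun L hL => hLs L (by simp [hL])
    obtain ⟨h1, h2⟩ := hI.measure_layer_le (Oracle.cnt I.baseOracle Ls)
      (L.filter fun l => l.2 = true) fun l hl l' hl' =>
        hLs L (by simp) l (Finset.mem_filter.1 hl).1 l' (Finset.mem_filter.1 hl').1
    have heq : {r | Oracle.Consistent (I.volumeOracle r) (L :: Ls)} =
        {r | ∀ l ∈ L.filter fun l => l.2 = true,
          Oracle.Bad (I.volumeOracle r) (Oracle.cnt I.baseOracle Ls) l.1} ∩
        {r | Oracle.Consistent (I.volumeOracle r) Ls} := by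
      ext r
      simp only [Set.mem_ofPred_eq, Set.mem_inter_iff, Oracle.Consistent, Finset.mem_filter,
        and_imp, cnt_volumeOracle_eq]
    have hle : ∀ x, Oracle.cnt I.baseOracle Ls x ≤ Oracle.cnt I.baseOracle (L :: Ls) x := by
      intro x
      rw [Oracle.cnt]
      exact Nat.le_add_right _ _
    rw [heq]
    constructor
    · refine MeasurableSet.inter ?_ ?_
      · refine tableAlgebra_mono I.law I.owner ?_ _ h1
        rintro c ⟨⟨l, hl, hc⟩, hc2⟩
        have hex : ∃ l ∈ L, c.1 ∈ Oracle.vars I.baseOracle l.1 :=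
          ⟨l, (Finset.mem_filter.1 hl).1, hc⟩
        change c.2 < Oracle.cnt I.baseOracle (L :: Ls) c.1
        rw [hc2, Oracle.cnt, if_pos hex]
        exact Nat.lt_succ_self _
      · refine tableAlgebra_mono I.law I.owner ?_ _ ih1
        intro c hc
        exact lt_of_lt_of_le hc (hle _)
    · rw [show Oracle.numLabels true (L :: Ls) =
        (L.filter fun l => l.2 = true).card + Oracle.numLabels true Ls by
          simp [Oracle.numLabels], pow_add]
      refine I.measure_inter_le ?_ h1 ih1 h2 ih2
      -- The layer `L` reads sample number `cnt Ls x` of each variable, while the deeper layers read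
      -- only smaller numbers; no sample is read twice.
      rw [Set.disjoint_left]
      rintro c ⟨-, hc⟩ hc'
      exact absurd hc' (by rw [Set.mem_ofPred_eq, hc]; exact lt_irrefl _)

/-- The neighbourhoods in which the next layer lies. -/
noncomputable def labelNbhd (l : ℕ × Bool) : Finset (ℕ × Bool) :=
  I.ball 2 l.1 ×ˢ Finset.univ

omit [StandardBorelSpace Ω] [Nonempty Ω] [Nonempty (Fin n)] in
lemma mem_layerSeqs_of_linked {L : Finset (ℕ × Bool)} {Ls : List (Finset (ℕ × Bool))}
    (h : Oracle.Linked (I.volumeOracle r) L Ls) :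
    Ls ∈ layerSeqs I.labelNbhd Ls.length L := by
  induction Ls generalizing L with
  | nil => simp [layerSeqs]
  | cons L' Ls ih =>
    simp only [List.length_cons, layerSeqs, Finset.mem_biUnion, Finset.mem_powerset,
      Finset.mem_image]
    refine ⟨L', fun l' hl' => ?_, Ls, ih h.2, rfl⟩
    obtain ⟨l, hl, hb⟩ := h.1 l' hl'
    rw [cball_volumeOracle_eq] at hb
    exact Finset.mem_biUnion.2 ⟨l, hl, by simp [labelNbhd, mem_ball, hb]⟩

open Classical in
/-- The layers that may give evidence for a resampling of `v`, whatever the random bits are. -/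
noncomputable def candidates (v h S : ℕ) (R : Set ℕ) : Finset (List (Finset (ℕ × Bool))) :=
  (layerSeqs I.labelNbhd h {(v, true)}).filter fun Ls =>
    (∀ L ∈ {(v, true)} :: Ls, Oracle.LayerOK I.baseOracle R L) ∧
    Oracle.Linked I.baseOracle {(v, true)} Ls ∧ Ls.length = h ∧
    Oracle.numLabels false ({(v, true)} :: Ls) ≤ Oracle.numLabels true ({(v, true)} :: Ls) ∧
    S ≤ Oracle.numLabels true ({(v, true)} :: Ls)

omit [StandardBorelSpace Ω] [Nonempty Ω] [Nonempty (Fin n)] in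
lemma mem_candidates {v h S : ℕ} {R : Set ℕ} {Ls : List (Finset (ℕ × Bool))} :
    Ls ∈ I.candidates v h S R ↔ Ls ∈ layerSeqs I.labelNbhd h {(v, true)} ∧
      (∀ L ∈ {(v, true)} :: Ls, Oracle.LayerOK I.baseOracle R L) ∧
      Oracle.Linked I.baseOracle {(v, true)} Ls ∧ Ls.length = h ∧
      Oracle.numLabels false ({(v, true)} :: Ls) ≤ Oracle.numLabels true ({(v, true)} :: Ls) ∧
      S ≤ Oracle.numLabels true ({(v, true)} :: Ls) := by
  unfold candidates
  simp only [Finset.mem_filter]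

omit [StandardBorelSpace Ω] [Nonempty Ω] [Nonempty (Fin n)] in
lemma layerOK_volumeOracle_iff {R : Set ℕ} {L : Finset (ℕ × Bool)} :
    Oracle.LayerOK (I.volumeOracle r) R L ↔ Oracle.LayerOK I.baseOracle R L := by
  simp only [Oracle.LayerOK, isSome_volumeOracle_eq, vars_volumeOracle_eq]

omit [StandardBorelSpace Ω] [Nonempty Ω] [Nonempty (Fin n)] in
lemma linked_volumeOracle_iff {L : Finset (ℕ × Bool)} {Ls : List (Finset (ℕ × Bool))} :
    Oracle.Linked (I.volumeOracle r) L Ls ↔ Oracle.Linked I.baseOracle L Ls := by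
  induction Ls generalizing L with
  | nil => rfl
  | cons L' Ls ih => simp only [Oracle.Linked, cball_volumeOracle_eq, ih]

-- All conditions except consistency concern the structure of the instance and not the bits, so a
-- finite union over fixed candidates remains.
omit [Nonempty (Fin n)] in
lemma setOf_evidence_eq (v h S : ℕ) (R : Set ℕ) :
    {r | Oracle.Evidence (I.volumeOracle r) v h S R} =
      ⋃ Ls ∈ I.candidates v h S R,
        {r | Oracle.Consistent (I.volumeOracle r) ({(v, true)} :: Ls)} := by
  ext r
  simp only [Set.mem_ofPred_eq, Set.mem_iUnion, mem_candidates, exists_prop]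
  constructor
  · rintro ⟨Ls, hlen, hlink, hok, hcons, h1, h2⟩
    refine ⟨Ls, ⟨hlen ▸ I.mem_layerSeqs_of_linked r hlink, fun L hL => ?_, ?_, hlen, h1, h2⟩,
      hcons⟩
    · exact (I.layerOK_volumeOracle_iff r).1 (hok L hL)
    · exact (I.linked_volumeOracle_iff r).1 hlink
  · rintro ⟨Ls, ⟨-, hok, hlink, hlen, h1, h2⟩, hcons⟩
    exact ⟨Ls, hlen, (I.linked_volumeOracle_iff r).2 hlink,
      fun L hL => (I.layerOK_volumeOracle_iff r).2 (hok L hL), hcons, h1, h2⟩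

omit [StandardBorelSpace Ω] [Nonempty Ω] [Nonempty (Fin n)] in
lemma exists_of_cnt_pos {O : ℕ → Option (NodeData Ω)} {Ls : List (Finset (ℕ × Bool))} {x : ℕ}
    (h : 0 < Oracle.cnt O Ls x) : ∃ L ∈ Ls, ∃ l ∈ L, x ∈ Oracle.vars O l.1 := by
  induction Ls with
  | nil => simp [Oracle.cnt] at h
  | cons L Ls ih =>
    by_cases hL : ∃ l ∈ L, x ∈ Oracle.vars O l.1
    · exact ⟨L, by simp, hL⟩
    · rw [Oracle.cnt, if_neg hL] at h
      obtain ⟨L', hL', hx⟩ := ih h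
      exact ⟨L', by simp [hL'], hx⟩

variable {I} in
/-- Evidence depends only on the samples of the variables of the region. -/
lemma HasParams.measurableSet_evidence {κ d : ℕ} {p : ℝ} (hI : I.HasParams κ d p) (v h S : ℕ)
    (R : Set ℕ) :
    MeasurableSet[I.sampleAlgebra {c | ∃ i ∈ R, c.1 ∈ Oracle.vars I.baseOracle i}]
      {r | Oracle.Evidence (I.volumeOracle r) v h S R} := by
  rw [setOf_evidence_eq]
  refine Finset.measurableSet_biUnion _ fun Ls hLs => ?_
  have hok := (I.mem_candidates.1 hLs).2.1
  refine tableAlgebra_mono I.law I.owner ?_ _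
    (hI.measure_consistent_le _ fun L hL => (hok L hL).2).1
  intro c hc
  obtain ⟨L, hL, l, hl, hx⟩ := exists_of_cnt_pos (Nat.zero_lt_of_lt hc)
  exact ⟨l.1, ((hok L hL).1 l hl).2, hx⟩

lemma numLabels_add (Ls : List (Finset (ℕ × Bool))) :
    Oracle.numLabels true Ls + Oracle.numLabels false Ls = (Ls.map Finset.card).sum := by
  induction Ls with
  | nil => rfl
  | cons L Ls ih =>
    have := Finset.card_filter_add_card_filter_not (s := L) fun l => l.2 = true
    simp only [Bool.not_eq_true] at this
    simp only [Oracle.numLabels, List.map_cons, List.sum_cons] at ih ⊢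
    lia

variable {I} in
/-- The probability of evidence. -/
lemma HasParams.measure_evidence_le {κ d : ℕ} {p : ℝ} (hI : I.HasParams κ d p)
    {q F A : ENNReal} (hF1 : 1 ≤ F) (hF : (q * F + 1) ^ (2 * (d + 1) ^ 2) ≤ F) (hq : q ≤ 1)
    (hA : A ≤ 1) (hp : ENNReal.ofReal p ≤ A * q ^ 2) (v h S : ℕ) (R : Set ℕ) :
    bitMeasure n {r | Oracle.Evidence (I.volumeOracle r) v h S R} ≤ A ^ S * F := by
  have hN : ∀ l, (I.labelNbhd l).card ≤ 2 * (d + 1) ^ 2 := by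
    intro l
    rw [labelNbhd, Finset.card_product, mul_comm]
    exact Nat.mul_le_mul (by simp) (hI.card_ball_le 2 l.1)
  rw [setOf_evidence_eq]
  calc bitMeasure n (⋃ Ls ∈ I.candidates v h S R,
        {r | Oracle.Consistent (I.volumeOracle r) ({(v, true)} :: Ls)})
      ≤ ∑ Ls ∈ I.candidates v h S R,
          bitMeasure n {r | Oracle.Consistent (I.volumeOracle r) ({(v, true)} :: Ls)} :=
        measure_biUnion_finset_le _ _
    _ ≤ ∑ Ls ∈ I.candidates v h S R, A ^ S * q ^ (Ls.map Finset.card).sum := by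
        refine Finset.sum_le_sum fun Ls hLs => ?_
        obtain ⟨-, hok, -, -, h1, h2⟩ := I.mem_candidates.1 hLs
        refine (hI.measure_consistent_le _ fun L hL => (hok L hL).2).2.trans ?_
        have hadd := numLabels_add ({(v, true)} :: Ls)
        simp only [List.map_cons, List.sum_cons, Finset.card_singleton] at hadd
        -- With `T` tested nodes, `p ^ T ≤ A ^ T * q ^ (2T)`. Here `A ^ T ≤ A ^ S`, and `2T` is at
        -- least the number of all nodes, so a factor `q` is left for each of them.
        refine (pow_le_pow_left' hp _).trans ?_
        rw [mul_pow, ← pow_mul]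
        exact mul_le_mul' (pow_le_pow_right_of_le_one' hA h2) (pow_le_pow_right_of_le_one' hq (by lia))
    _ ≤ ∑ Ls ∈ layerSeqs I.labelNbhd h {(v, true)},
          A ^ S * q ^ (Ls.map Finset.card).sum :=
        Finset.sum_le_sum_of_subset (fun Ls hLs => (I.mem_candidates.1 hLs).1)
    _ ≤ A ^ S * F := by
        rw [← Finset.mul_sum]
        gcongr
        simpa using sum_layerSeqs_le I.labelNbhd hN hF1 hF h {(v, true)}

end events

end LLLInstance

/-! ### The size of clusters of suspects -/

namespace LLLInstance

variable {Ω : Type*} [MeasurableSpace Ω] {n : ℕ} (I : LLLInstance Ω n)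

/-- The lists of `k` nodes in which each node is within distance `D` of a later one or of `v`. -/
noncomputable def growthLists (D v : ℕ) : ℕ → Finset (List ℕ)
  | 0 => {[]}
  | k + 1 => (growthLists D v k).biUnion fun l =>
      ((v :: l).toFinset.biUnion (I.ball D)).image (· :: l)

lemma length_of_mem_growthLists {D v k : ℕ} {l : List ℕ} (h : l ∈ I.growthLists D v k) :
    l.length = k := by
  induction k generalizing l with
  | zero => simpa [growthLists] using h
  | succ k ih =>
    simp only [growthLists, Finset.mem_biUnion, Finset.mem_image] at h
    obtain ⟨l', hl', w, -, rfl⟩ := h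
    simp [ih hl']

variable {I} in
lemma HasParams.card_growthLists_le {κ d : ℕ} {p : ℝ} (hI : I.HasParams κ d p) (D v : ℕ)
    {k m : ℕ} (hk : k ≤ m) : (I.growthLists D v k).card ≤ (m * (d + 1) ^ D) ^ k := by
  induction k with
  | zero => simp [growthLists]
  | succ k ih =>
    rw [growthLists, pow_succ]
    refine (Finset.card_biUnion_le_card_mul _ _ (m * (d + 1) ^ D) fun l hl => ?_).trans
      (Nat.mul_le_mul_right _ (ih (by lia)))
    refine Finset.card_image_le.trans ((Finset.card_biUnion_le_card_mul _ _ _ fun u _ =>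
      hI.card_ball_le D u).trans (Nat.mul_le_mul_right _ ?_))
    refine (List.toFinset_card_le _).trans ?_
    rw [List.length_cons, I.length_of_mem_growthLists hl]
    exact hk

variable {I} in
/-- A large cluster contains many nodes of `M` that are far apart. -/
lemma HasParams.exists_growthList {κ d : ℕ} {p : ℝ} (hI : I.HasParams κ d p)
    {r : Fin n → ℕ → Bool} {M : Set ℕ} {D v k : ℕ}
    (hbig : ∀ C : Finset ℕ, C.card ≤ k * (d + 1) ^ D →
      ¬ Oracle.reach (I.volumeOracle r) M v ⊆ C) {j : ℕ} (hj : j ≤ k) :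
    ∃ l ∈ I.growthLists (D + 2) v j, (∀ w ∈ l, w ∈ M) ∧
      l.Pairwise fun w u => w ∉ Oracle.cball I.baseOracle D u := by
  classical
  induction j with
  | zero => exact ⟨[], by simp [growthLists], by simp, by simp⟩
  | succ j ih =>
    obtain ⟨l, hl, hM, hfar⟩ := ih (by lia)
    let C := (v :: l).toFinset.biUnion (I.ball D)
    have hC : C.card ≤ k * (d + 1) ^ D := by
      refine (Finset.card_biUnion_le_card_mul _ _ _ fun u _ => hI.card_ball_le D u).trans
        (Nat.mul_le_mul_right _ ((List.toFinset_card_le _).trans ?_))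
      rw [List.length_cons, I.length_of_mem_growthLists hl]
      exact hj
    obtain ⟨w, hw, hwC⟩ := Set.not_subset.1 (hbig C hC)
    -- The first node outside `C` on a path from `v` belongs to `M` and is within distance 2 of `C`,
    -- so within `D + 2` of a chosen node or of `v`.
    have key : ∀ w ∈ Oracle.reach (I.volumeOracle r) M v, w ∈ C ∨
        ∃ b ∈ M, b ∉ C ∧ ∃ u ∈ v :: l, b ∈ Oracle.cball I.baseOracle (D + 2) u := by
      intro w hw
      induction hw with
      | refl =>
        left
        exact Finset.mem_biUnion.2 ⟨v, by simp, I.mem_ball.2 (Oracle.self_mem_cball _ _)⟩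
      | @tail a b _ hab ih =>
        rcases ih with ha | hex
        · by_cases hb : b ∈ C
          · exact Or.inl hb
          · right
            obtain ⟨u, hu, hau⟩ := Finset.mem_biUnion.1 ha
            refine ⟨b, hab.2, hb, u, by simpa using hu, ?_⟩
            have h1 := hab.1
            rw [cball_volumeOracle_eq] at h1
            exact Oracle.cball_trans (I.mem_ball.1 hau) h1
        · exact Or.inr hex
    rcases key w hw with h | ⟨b, hbM, hbC, u, hu, hbu⟩
    · exact absurd h hwC
    · refine ⟨b :: l, ?_, ?_, ?_⟩
      · rw [growthLists, Finset.mem_biUnion]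
        refine ⟨l, hl, Finset.mem_image.2 ⟨b, ?_, rfl⟩⟩
        exact Finset.mem_biUnion.2 ⟨u, by simpa using hu, I.mem_ball.2 hbu⟩
      · intro w hw
        rcases List.mem_cons.1 hw with rfl | hw
        · exact hbM
        · exact hM w hw
      · refine List.pairwise_cons.2 ⟨fun u hu hbu => hbC ?_, hfar⟩
        exact Finset.mem_biUnion.2 ⟨u, by simp [hu], I.mem_ball.2 hbu⟩

section events

variable [StandardBorelSpace Ω] [Nonempty Ω] [Nonempty (Fin n)]

variable {I} in
/-- Being suspects is independent for nodes that are far apart. -/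
lemma HasParams.measure_suspects_le {κ d : ℕ} {p : ℝ} (hI : I.HasParams κ d p) {h S R : ℕ}
    {p' : ENNReal} (hp' : ∀ w, bitMeasure n {r | Oracle.Evidence (I.volumeOracle r) w h S
      (Oracle.cball I.baseOracle R w)} ≤ p') (l : List ℕ)
    (hl : l.Pairwise fun w u => w ∉ Oracle.cball I.baseOracle (2 * R + 1) u) :
    MeasurableSet[I.sampleAlgebra {c | ∃ w ∈ l, ∃ i ∈ Oracle.cball I.baseOracle R w,
        c.1 ∈ Oracle.vars I.baseOracle i}]
      {r | ∀ w ∈ l, w ∈ Oracle.suspects (I.volumeOracle r) h S R} ∧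
    bitMeasure n {r | ∀ w ∈ l, w ∈ Oracle.suspects (I.volumeOracle r) h S R} ≤
      p' ^ l.length := by
  induction l with
  | nil => simp
  | cons w l ih =>
    obtain ⟨hw, hl⟩ := List.pairwise_cons.1 hl
    obtain ⟨ih1, ih2⟩ := ih hl
    have heq : {r | ∀ w' ∈ w :: l, w' ∈ Oracle.suspects (I.volumeOracle r) h S R} =
        {r | Oracle.Evidence (I.volumeOracle r) w h S (Oracle.cball I.baseOracle R w)} ∩
          {r | ∀ w ∈ l, w ∈ Oracle.suspects (I.volumeOracle r) h S R} := by
      ext r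
      simp only [Set.mem_ofPred_eq, Set.mem_inter_iff, List.forall_mem_cons]
      refine and_congr_left fun _ => ?_
      rw [Oracle.suspects, Set.mem_ofPred_eq, cball_volumeOracle_eq]
    have hm := hI.measurableSet_evidence w h S (Oracle.cball I.baseOracle R w)
    rw [heq]
    constructor
    · refine MeasurableSet.inter ?_ ?_
      · refine tableAlgebra_mono I.law I.owner ?_ _ hm
        rintro c ⟨i, hi, hc⟩
        exact ⟨w, by simp, i, hi, hc⟩
      · refine tableAlgebra_mono I.law I.owner ?_ _ ih1
        rintro c ⟨u, hu, hc⟩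
        exact ⟨u, by simp [hu], hc⟩
    · rw [List.length_cons, pow_succ']
      refine I.measure_inter_le ?_ hm ih1 (hp' w) ih2
      rw [Set.disjoint_left]
      rintro c ⟨i, hi, hc⟩ ⟨u, hu, i', hi', hc'⟩
      -- If the two regions shared a variable, their centres would be within distance `R + 1 + R`.
      refine hw u hu ?_
      have hnet : Oracle.IsNetwork I.baseOracle := I.isNetwork_volumeOracle _
      have h1 := Oracle.cball_trans (Oracle.cball_trans hi' (hnet.mem_cball_of_share hc' hc))
        (hnet.mem_cball_symm hi)
      exact Oracle.cball_mono (by lia) u h1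

variable {I} in
/-- Large clusters are unlikely. -/
lemma HasParams.measure_large_cluster_le {κ d : ℕ} {p : ℝ} (hI : I.HasParams κ d p)
    {h S R : ℕ} {p' : ENNReal} (hp' : ∀ w, bitMeasure n {r | Oracle.Evidence (I.volumeOracle r) w
      h S (Oracle.cball I.baseOracle R w)} ≤ p') (k v : ℕ) :
    bitMeasure n {r | ∀ C : Finset ℕ, C.card ≤ k * (d + 1) ^ (2 * R + 1) →
        ¬ Oracle.reach (I.volumeOracle r) (Oracle.suspects (I.volumeOracle r) h S R) v ⊆ C} ≤
      (k * (d + 1) ^ (2 * R + 3) * p') ^ k := by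
  classical
  let F := (I.growthLists (2 * R + 1 + 2) v k).filter fun l =>
    l.Pairwise fun w u => w ∉ Oracle.cball I.baseOracle (2 * R + 1) u
  calc _ ≤ bitMeasure n (⋃ l ∈ F,
        {r | ∀ w ∈ l, w ∈ Oracle.suspects (I.volumeOracle r) h S R}) := by
        refine measure_mono fun r hr => ?_
        obtain ⟨l, hl, hM, hfar⟩ := hI.exists_growthList hr le_rfl
        exact Set.mem_biUnion (show l ∈ (F : Set (List ℕ)) from
          Finset.mem_coe.2 (Finset.mem_filter.2 ⟨hl, hfar⟩)) hM
    _ ≤ ∑ l ∈ F, bitMeasure n {r | ∀ w ∈ l, w ∈ Oracle.suspects (I.volumeOracle r) h S R} :=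
        measure_biUnion_finset_le _ _
    _ ≤ ∑ _l ∈ F, p' ^ k := by
        refine Finset.sum_le_sum fun l hl => ?_
        obtain ⟨hl, hfar⟩ := Finset.mem_filter.1 hl
        rw [← I.length_of_mem_growthLists hl]
        exact (hI.measure_suspects_le hp' l hfar).2
    _ ≤ ((k * (d + 1) ^ (2 * R + 3)) ^ k : ℕ) * p' ^ k := by
        rw [Finset.sum_const, nsmul_eq_mul]
        gcongr
        exact (Finset.card_filter_le _ _).trans (hI.card_growthLists_le _ v le_rfl)
    _ = _ := by
        push_cast
        rw [mul_pow, mul_pow, mul_pow]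

end events

end LLLInstance

lemma LLLInstance.volumeOracle_mem_image {Ω : Type*} [MeasurableSpace Ω] {n : ℕ}
    (I : LLLInstance Ω n) {r : Fin n → ℕ → Bool} {i : ℕ}
    (h : (I.volumeOracle r i).isSome) : i ∈ Finset.univ.image I.id := by
  obtain ⟨v, rfl⟩ := (I.isSome_volumeOracle r).1 h
  simp

/-! ### The local algorithm and its correctness -/

section algorithm

variable {Ω : Type*} [MeasurableSpace Ω] [StandardBorelSpace Ω] [Nonempty Ω]

open Classical in
/-- The nodes that may be resampled in each round when the process is run around the node `i`. -/
noncomputable def localRegion (τ K i : ℕ) (kn : ℕ → Option (NodeData Ω)) (t : ℕ) : Set ℕ :=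
  if t < 4 * τ then Set.univ
  else Oracle.reach kn (Oracle.suspects kn K (4 * τ) (10 * τ)) i

/-- Explore the neighbourhood of the cluster of the queried node, run `K` rounds of parallel
resampling there, and output the resulting values. -/
noncomputable def resamplingAlgorithm (Ω : Type*) [MeasurableSpace Ω] [StandardBorelSpace Ω]
    [Nonempty Ω] (τ K q : ℕ) : VolumeAlgorithm Ω := fun i =>
  Oracle.explore (fun kn => Oracle.clusterBall kn K (4 * τ) (10 * τ) (10 * τ + 4) i)
    (fun kn x => Oracle.tab kn x (Oracle.counts kn (localRegion τ K i kn) K x)) i q fun _ => none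

namespace LLLInstance

variable {n : ℕ} (I : LLLInstance Ω n)

/-- The final values of the global process. -/
noncomputable def finalValue (r : Fin n → ℕ → Bool) (K x : ℕ) : Ω :=
  Oracle.tab (I.volumeOracle r) x
    (Oracle.counts (I.volumeOracle r) (fun _ => Set.univ) K x)

variable {I} {r : Fin n → ℕ → Bool} {τ K : ℕ}

lemma rounds_subset_suspects (hK : K ≤ 2 ^ τ)
    (hbig : ∀ v, ¬ Oracle.Evidence (I.volumeOracle r) (I.id v) K K Set.univ) (t : ℕ)
    (hτ : 4 * τ ≤ t) (ht : t < K) :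
    Oracle.rounds (I.volumeOracle r) t ⊆
      Oracle.suspects (I.volumeOracle r) K (4 * τ) (10 * τ) := by
  intro i hi
  obtain ⟨v, rfl⟩ := (I.isSome_volumeOracle r).1 (Oracle.isSome_of_bad hi.1)
  exact ((I.isNetwork_volumeOracle r).evidence_of_late (fun i h => I.volumeOracle_mem_image h)
    hi ht.le hτ hK).resolve_left (hbig v)

/-- The bad node of smallest identifier is always selected. A bad event surviving `K` rounds would
thus cause a resampling in round `K`, whose past reaches through all earlier rounds. -/
lemma not_bad_of_no_evidence
    (hbig : ∀ v, ¬ Oracle.Evidence (I.volumeOracle r) (I.id v) K K Set.univ) (v : Fin n) :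
    ¬ Oracle.Bad (I.volumeOracle r)
      (Oracle.counts (I.volumeOracle r) (fun _ => Set.univ) K) (I.id v) := by
  classical
  intro hb
  have hex : ∃ i, Oracle.Bad (I.volumeOracle r)
      (Oracle.counts (I.volumeOracle r) (fun _ => Set.univ) K) i := ⟨_, hb⟩
  have hmin := Nat.find_spec hex
  obtain ⟨w, hw⟩ := (I.isSome_volumeOracle r).1 (Oracle.isSome_of_bad hmin)
  have hsel : Nat.find hex ∈ Oracle.rounds (I.volumeOracle r) K := by
    refine ⟨hmin, fun j hj hbj => lt_of_le_of_ne (Nat.find_min' hex hbj) ?_⟩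
    intro heq
    rw [← heq] at hj
    exact (I.isNetwork_volumeOracle r).irrefl _ hj
  rw [← hw] at hsel
  exact hbig w ((I.isNetwork_volumeOracle r).evidence_of_long
    (fun i h => I.volumeOracle_mem_image h) hsel le_rfl (Nat.le_succ K))

/-- When the cluster is small, `q` probes suffice to learn it with its margin; without large
evidence, late resampling is confined to suspects, so the local replay agrees with the global
process. -/
lemma HasParams.run_resamplingAlgorithm {κ d : ℕ} {p : ℝ} (hI : I.HasParams κ d p) {q : ℕ}
    (hK : K ≤ 2 ^ τ) (hq : K * (d + 1) ^ (20 * τ + 1) * (d + 1) ^ (10 * τ + 4) ≤ q)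
    (hbig : ∀ v, ¬ Oracle.Evidence (I.volumeOracle r) (I.id v) K K Set.univ) (v : Fin n)
    {C : Finset ℕ} (hC : C.card ≤ K * (d + 1) ^ (20 * τ + 1))
    (hreach : Oracle.reach (I.volumeOracle r)
      (Oracle.suspects (I.volumeOracle r) K (4 * τ) (10 * τ)) (I.id v) ⊆ C)
    {x : ℕ} (hx : x ∈ I.vbl v) :
    (resamplingAlgorithm Ω τ K q (I.id v)).run (I.volumeOracle r) x = I.finalValue r K x := by
  classical
  have hnet := I.isNetwork_volumeOracle r
  let B := C.biUnion (I.ball (10 * τ + 4))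
  have hBcard : B.card ≤ q := (Finset.card_biUnion_le_card_mul _ _ _ fun u _ =>
    hI.card_ball_le _ u).trans ((Nat.mul_le_mul_right _ hC).trans hq)
  have hnone : Oracle.restrict (I.volumeOracle r) ((∅ : Finset ℕ) : Set ℕ) = fun _ => none := by
    funext i; simp [Oracle.restrict]
  obtain ⟨E, hE, hrun⟩ := Oracle.run_explore
    (fun kn => Oracle.clusterBall kn K (4 * τ) (10 * τ) (10 * τ + 4) (I.id v))
    (fun kn x => Oracle.tab kn x (Oracle.counts kn (localRegion τ K (I.id v) kn) K x)) (I.id v)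
    (I.volumeOracle r) B (fun E i hi hW => by
      constructor
      · obtain ⟨w, hw, hiw⟩ := hnet.clusterBall_restrict_subset hW
        rw [cball_volumeOracle_eq] at hiw
        exact Finset.mem_biUnion.2 ⟨w, hreach hw, I.mem_ball.2 hiw⟩
      · rcases hi with rfl | ⟨u, hu⟩
        · rw [volumeOracle_id]; rfl
        · exact Oracle.isSome_of_mem_adj hnet (Oracle.adj_restrict_subset u hu)) q ∅
    (by simpa using hBcard)
  rw [hnone] at hrun
  obtain ⟨heq, hballs⟩ := hnet.reach_restrict (by lia) hE
  have hself : I.id v ∈ Oracle.reach (I.volumeOracle r)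
      (Oracle.suspects (I.volumeOracle r) K (4 * τ) (10 * τ)) (I.id v) := .refl
  have hxv : x ∈ Oracle.vars (I.volumeOracle r) (I.id v) := by rwa [vars_volumeOracle]
  rw [resamplingAlgorithm, hrun, finalValue]
  have hcounts : Oracle.counts (Oracle.restrict (I.volumeOracle r) E)
      (localRegion τ K (I.id v) (Oracle.restrict (I.volumeOracle r) E)) K x =
      Oracle.counts (I.volumeOracle r) (fun _ => Set.univ) K x := by
    have hA : ∀ t < 4 * τ, localRegion τ K (I.id v) (Oracle.restrict (I.volumeOracle r) E) t =
        Set.univ := fun t ht => if_pos ht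
    -- If `K ≤ 4τ` there is no late phase. The margin `10τ + 4` covers the radii `2K + 1` and `8τ +
    -- 2` required for the early rounds in the two cases.
    rcases le_total K (4 * τ) with h | h
    · refine hnet.counts_restrict_early hA h (fun j hj => hballs _ hself ?_) hxv
      exact Oracle.cball_mono (by lia) _ hj
    · refine hnet.counts_restrict_late (M := Oracle.suspects (I.volumeOracle r) K (4 * τ) (10 * τ))
        hA (fun t ht => ?_) (fun w hw => ?_) (fun w hw => ?_)
        (fun t => rounds_subset_suspects hK hbig t) h le_rfl hself (Oracle.self_mem_cball _ _) hxv
      · rw [localRegion, if_neg (by lia), heq]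
      · exact (Oracle.cball_mono (by lia) _).trans (hballs w hw)
      · exact (Oracle.cball_mono (by lia) _).trans (hballs w hw)
  change Oracle.tab _ x (Oracle.counts _ _ K x) = _
  rw [hcounts]
  exact hnet.tab_restrict ((Oracle.cball_mono (by lia) _).trans (hballs _ hself)) hxv _

lemma isSolution_of_eq_finalValue [Nonempty (Fin n)] {out : Fin n → ℕ → Ω}
    (hout : ∀ v, ∀ x ∈ I.vbl v, out v x = I.finalValue r K x)
    (hbig : ∀ v, ¬ Oracle.Evidence (I.volumeOracle r) (I.id v) K K Set.univ) :
    I.IsSolution out := by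
  refine ⟨I.finalValue r K, hout, fun v hv => not_bad_of_no_evidence hbig v ?_⟩
  rw [bad_volumeOracle_iff]
  change (fun x : I.vbl v => sampleTable I.law I.owner
      (x, Oracle.counts (I.volumeOracle r) (fun _ => Set.univ) K x) r) ∈ I.bad v
  convert hv using 1
  exact funext fun x => (I.tab_volumeOracle r x.2).symm

/-- A union bound over the nodes and the two ways to fail: large evidence somewhere, and a large
cluster. -/
lemma HasParams.measure_not_isSolution_le [Nonempty (Fin n)] {κ d : ℕ} {p : ℝ}
    (hI : I.HasParams κ d p) {q : ℕ} (hK : K ≤ 2 ^ τ)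
    (hq : K * (d + 1) ^ (20 * τ + 1) * (d + 1) ^ (10 * τ + 4) ≤ q) {q₀ F A : ENNReal}
    (hF1 : 1 ≤ F) (hF : (q₀ * F + 1) ^ (2 * (d + 1) ^ 2) ≤ F) (hq₀ : q₀ ≤ 1)
    (hA : A ≤ 1) (hp : ENNReal.ofReal p ≤ A * q₀ ^ 2) :
    bitMeasure n {r | ¬ I.IsSolution fun v =>
        (resamplingAlgorithm Ω τ K q (I.id v)).run (I.volumeOracle r)} ≤
      n * (A ^ K * F + (K * (d + 1) ^ (20 * τ + 3) * (A ^ (4 * τ) * F)) ^ K) := by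
  let X : Fin n → Set (Fin n → ℕ → Bool) := fun v =>
    {r | Oracle.Evidence (I.volumeOracle r) (I.id v) K K Set.univ}
  let Y : Fin n → Set (Fin n → ℕ → Bool) := fun v =>
    {r | ∀ C : Finset ℕ, C.card ≤ K * (d + 1) ^ (2 * (10 * τ) + 1) →
        ¬ Oracle.reach (I.volumeOracle r)
          (Oracle.suspects (I.volumeOracle r) K (4 * τ) (10 * τ)) (I.id v) ⊆ C}
  calc _ ≤ bitMeasure n (⋃ v, X v ∪ Y v) := by
        refine measure_mono fun r hr => ?_
        by_contra hcon
        simp only [Set.mem_iUnion, Set.mem_union, not_exists, not_or] at hcon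
        refine hr (isSolution_of_eq_finalValue (r := r) (K := K) (fun v x hx => ?_)
          fun v => (hcon v).1)
        have h2 : ¬ ∀ C : Finset ℕ, C.card ≤ K * (d + 1) ^ (2 * (10 * τ) + 1) →
          ¬ Oracle.reach (I.volumeOracle r)
          (Oracle.suspects (I.volumeOracle r) K (4 * τ) (10 * τ)) (I.id v) ⊆ C := (hcon v).2
        push Not at h2
        obtain ⟨C, hC, hsub⟩ := h2
        refine hI.run_resamplingAlgorithm hK hq (fun v => (hcon v).1) v (C := C) ?_ hsub hx
        rwa [show 2 * (10 * τ) = 20 * τ by ring] at hC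
    _ ≤ ∑ v, bitMeasure n (X v ∪ Y v) := measure_iUnion_fintype_le _ _
    _ ≤ ∑ _v : Fin n, (A ^ K * F + (K * (d + 1) ^ (20 * τ + 3) * (A ^ (4 * τ) * F)) ^ K) := by
        refine Finset.sum_le_sum fun v _ => (measure_union_le _ _).trans (add_le_add ?_ ?_)
        · exact hI.measure_evidence_le hF1 hF hq₀ hA hp _ _ _ _
        · have := hI.measure_large_cluster_le (h := K) (S := 4 * τ) (R := 10 * τ)
            (fun w => hI.measure_evidence_le hF1 hF hq₀ hA hp w K (4 * τ) _) K (I.id v)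
          rwa [show 2 * (10 * τ) + 3 = 20 * τ + 3 by ring] at this
    _ = _ := by simp [mul_add]

end LLLInstance

end algorithm

/-! ### Choice of parameters -/

section numerics

/-- This is the condition on `q` and `F` in `sum_layerSeqs_le` for `q = 1 / (8a²)`, `F = 4` and `Δ =
2a²`, with `a = d + 1`. It holds because `(1 + 1 / (2a²)) ^ (2a²) ≤ e`. -/
lemma one_add_inv_pow_le_four {a : ℕ} (ha : 0 < a) :
    (1 / (8 * (a : ℝ) ^ 2) * 4 + 1) ^ (2 * a ^ 2) ≤ 4 := by
  have ha' : (0 : ℝ) < a := by exact_mod_cast ha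
  have h : (1 : ℝ) / (8 * (a : ℝ) ^ 2) * 4 + 1 ≤ Real.exp (1 / (2 * (a : ℝ) ^ 2)) := by
    refine le_trans (le_of_eq ?_) (Real.add_one_le_exp _)
    field_simp
    ring
  calc _ ≤ Real.exp (1 / (2 * (a : ℝ) ^ 2)) ^ (2 * a ^ 2) :=
        pow_le_pow_left₀ (by positivity) h _
    _ = Real.exp 1 := by
        rw [← Real.exp_nat_mul]
        congr 1
        push_cast
        field_simp
    _ ≤ 4 := by linarith [Real.exp_one_lt_d9]

/-- For `y = p ^ (1 / 20)` the hypothesis on `p` becomes `d * y ^ 2 ≤ 1`, which turns the later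
estimates into comparisons of monomials in `d + 1` and `y`. The threshold `2 ^ 132` is what makes `2
^ 66 * y ≤ 1`, as consumed by `cluster_weight_le`. -/
lemma exists_twentieth_root {d : ℕ} {p : ℝ} (hd : 2 ^ 132 ≤ d) (hp : 0 < p)
    (hpd : p ≤ (d : ℝ) ^ (-10 : ℝ)) :
    0 < p ^ (1 / 20 : ℝ) ∧ (p ^ (1 / 20 : ℝ)) ^ 20 = p ∧
      (d + 1 : ℝ) * (p ^ (1 / 20 : ℝ)) ^ 2 ≤ 2 ∧ 2 ^ 66 * p ^ (1 / 20 : ℝ) ≤ 1 := by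
  have hy : 0 < p ^ (1 / 20 : ℝ) := Real.rpow_pos_of_pos hp _
  have hy20 : (p ^ (1 / 20 : ℝ)) ^ 20 = p := by
    rw [← Real.rpow_natCast, ← Real.rpow_mul hp.le]
    norm_num
  set y := p ^ (1 / 20 : ℝ)
  have hd' : (2 : ℝ) ^ 132 ≤ d := by exact_mod_cast hd
  have hd0 : (0 : ℝ) < d := lt_of_lt_of_le (by positivity) hd'
  have h1 : (d * y ^ 2) ^ 10 ≤ 1 := by
    have h2 : (d : ℝ) ^ (-10 : ℝ) = ((d : ℝ) ^ 10)⁻¹ := by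
      rw [Real.rpow_neg hd0.le]
      norm_cast
    rw [h2] at hpd
    calc (d * y ^ 2) ^ 10 = (d : ℝ) ^ 10 * y ^ 20 := by ring
      _ ≤ (d : ℝ) ^ 10 * ((d : ℝ) ^ 10)⁻¹ := by rw [hy20]; gcongr
      _ = 1 := mul_inv_cancel₀ (by positivity)
  have h3 : d * y ^ 2 ≤ 1 := (pow_le_one_iff_of_nonneg (by positivity) (by norm_num)).1 h1
  refine ⟨hy, hy20, ?_, ?_⟩
  · have : (d + 1 : ℝ) ≤ 2 * d := by linarith [show (1 : ℝ) ≤ 2 ^ 132 by norm_num]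
    calc _ ≤ 2 * d * y ^ 2 := by gcongr
      _ ≤ 2 := by linarith
  · have : (2 ^ 66 * y) ^ 2 ≤ 1 := by
      calc (2 ^ 66 * y) ^ 2 = 2 ^ 132 * y ^ 2 := by ring
        _ ≤ d * y ^ 2 := by gcongr
        _ ≤ 1 := h3
    exact (pow_le_one_iff_of_nonneg (by positivity) (by norm_num)).1 this

variable {a y : ℝ}

lemma weight_le (ha : 0 ≤ a) (hy : 0 < y) (hay : a * y ^ 2 ≤ 2) :
    64 * a ^ 4 * y ^ 20 ≤ 1024 * y ^ 12 := by
  calc 64 * a ^ 4 * y ^ 20 = 64 * (a * y ^ 2) ^ 4 * y ^ 12 := by ring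
    _ ≤ 64 * 2 ^ 4 * y ^ 12 := by gcongr
    _ = _ := by ring

lemma weight_le_root (ha : 0 ≤ a) (hy : 0 < y) (hay : a * y ^ 2 ≤ 2) (hsmall : 2 ^ 66 * y ≤ 1) :
    64 * a ^ 4 * y ^ 20 ≤ y := by
  have hy1 : y ≤ 1 := by linarith
  calc _ ≤ 1024 * y ^ 12 := weight_le ha hy hay
    _ = 1024 * y * y ^ 10 * y := by ring
    _ ≤ 1 * 1 * y := by
        have : y ^ 10 ≤ 1 := pow_le_one₀ hy.le hy1
        gcongr
        linarith
    _ = y := by ring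

/-- Growing the cluster costs `a ^ (20τ + 3)` and the weight `a ^ (16τ)`. Each `a` is paid by `y ^
2` out of `p ^ (4τ) = y ^ (80τ)`; the remaining `y ^ (8τ - 6)` absorbs `K ≤ 2 ^ τ` and the
constants, apart from one factor `y`. -/
lemma cluster_weight_le (ha : 0 ≤ a) (hy : 0 < y) (hay : a * y ^ 2 ≤ 2)
    (hsmall : 2 ^ 66 * y ≤ 1) {τ K : ℕ} (hτ : 1 ≤ τ) (hK : K ≤ 2 ^ τ) :
    K * a ^ (20 * τ + 3) * ((64 * a ^ 4 * y ^ 20) ^ (4 * τ) * 4) ≤ y := by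
  obtain ⟨s, rfl⟩ : ∃ s, τ = s + 1 := ⟨τ - 1, by lia⟩
  have hK' : (K : ℝ) ≤ 2 ^ (s + 1) := by exact_mod_cast hK
  have hy1 : y ≤ 1 := by linarith
  calc _ ≤ 2 ^ (s + 1) * a ^ (20 * (s + 1) + 3) * ((1024 * y ^ 12) ^ (4 * (s + 1)) * 4) := by
        have := weight_le ha hy hay
        have h0 : 0 ≤ 64 * a ^ 4 * y ^ 20 := by positivity
        generalize 64 * a ^ 4 * y ^ 20 = α at this h0
        gcongr
    _ = 2 ^ (s + 1) * 1024 ^ (4 * (s + 1)) * 4 * (a * y ^ 2) ^ (20 * s + 23) *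
          y ^ (8 * s + 2) := by
        rw [mul_pow, mul_pow, ← pow_mul, ← pow_mul]
        ring
    _ ≤ 2 ^ (s + 1) * 1024 ^ (4 * (s + 1)) * 4 * 2 ^ (20 * s + 23) * y ^ (8 * s + 2) := by
        gcongr
    _ = (2 ^ 61 * y ^ 8) ^ s * (2 ^ 66 * y) * y := by
        rw [show (1024 : ℝ) = 2 ^ 10 by norm_num, mul_pow, ← pow_mul, ← pow_mul, ← pow_mul]
        ring
    _ ≤ 1 * 1 * y := by
        have h8 : 2 ^ 61 * y ^ 8 ≤ 1 := by
          calc 2 ^ 61 * y ^ 8 = (2 ^ 61 * y) * y ^ 7 := by ring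
            _ ≤ 1 * 1 := by
              have : y ^ 7 ≤ 1 := pow_le_one₀ hy.le hy1
              gcongr
              linarith
            _ = 1 := by norm_num
        have : (2 ^ 61 * y ^ 8) ^ s ≤ 1 := pow_le_one₀ (by positivity) h8
        gcongr
    _ = y := by ring

/-- The number of rounds of the algorithm. -/
@[irreducible]
noncomputable def numRounds (c : ℝ) (n : ℕ) (p : ℝ) : ℕ :=
  ⌈20 * (c + 1) * Real.logb (1 / p) n⌉₊ + 20

lemma logb_one_div_nonneg {n : ℕ} {p : ℝ} (hn : 1 ≤ n) (hp : 0 < p) (hp1 : 5 * p ≤ 1) :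
    0 ≤ Real.logb (1 / p) n := by
  refine Real.logb_nonneg ?_ (by exact_mod_cast hn)
  rw [lt_div_iff₀ hp]
  linarith

/-- The `20 * (c + 1) * log_{1/p} n` rounds turn `p ^ (1 / 20)` into `n ^ (-(c + 1))`, which
survives the union bound over `n` nodes. The extra 20 rounds give a factor `p` that absorbs the 5.
-/
lemma root_pow_numRounds_le {c p : ℝ} {n : ℕ} (hn : 1 ≤ n) (hp : 0 < p) (hp1 : 5 * p ≤ 1) :
    5 * (n : ℝ) * (p ^ (1 / 20 : ℝ)) ^ numRounds c n p ≤ (n : ℝ) ^ (-c) := by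
  have hn0 : (0 : ℝ) < n := by exact_mod_cast hn
  set L := Real.logb (1 / p) n with hL
  have hpL : p ^ (-L) = n := by
    rw [Real.rpow_neg hp.le, ← Real.inv_rpow hp.le, ← one_div]
    refine Real.rpow_logb (by positivity) ?_ hn0
    rw [ne_eq, div_eq_iff hp.ne']
    linarith
  have hle : (c + 1) * L + 1 ≤ 1 / 20 * (numRounds c n p : ℝ) := by
    have := Nat.le_ceil (20 * (c + 1) * L)
    rw [numRounds]
    push_cast
    linarith
  have hKey : (p ^ (1 / 20 : ℝ)) ^ numRounds c n p ≤ (n : ℝ) ^ (-(c + 1)) * p := by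
    calc _ = p ^ (1 / 20 * (numRounds c n p : ℝ)) := by
          rw [← Real.rpow_natCast, ← Real.rpow_mul hp.le]
      _ ≤ p ^ ((c + 1) * L + 1) := Real.rpow_le_rpow_of_exponent_ge hp (by linarith) hle
      _ = (n : ℝ) ^ (-(c + 1)) * p := by
          rw [Real.rpow_add hp, Real.rpow_one, ← hpL, ← Real.rpow_mul hp.le]
          congr 2
          ring
  calc 5 * (n : ℝ) * (p ^ (1 / 20 : ℝ)) ^ numRounds c n p
      ≤ 5 * (n : ℝ) * ((n : ℝ) ^ (-(c + 1)) * p) := by gcongr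
    _ = (n : ℝ) ^ (1 : ℝ) * (n : ℝ) ^ (-(c + 1)) * (5 * p) := by rw [Real.rpow_one]; ring
    _ ≤ (n : ℝ) ^ (1 : ℝ) * (n : ℝ) ^ (-(c + 1)) * 1 := by gcongr
    _ = (n : ℝ) ^ (-c) := by
        rw [mul_one, ← Real.rpow_add hn0]
        congr 1
        ring

/-- The constant in the exponent of the probe bound. -/
noncomputable def probeConstant (c : ℝ) : ℝ :=
  71 * (1 + (Real.log (20 * c + 41) + 1) / Real.log 2)

/-- The number of probes of the algorithm. -/
@[irreducible]
noncomputable def numProbesBound (c : ℝ) (n d : ℕ) (p : ℝ) : ℕ :=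
  2 ^ Nat.clog 2 (numRounds c n p) * (d + 1) ^ (30 * Nat.clog 2 (numRounds c n p) + 5)

lemma clog_numRounds_le {c p : ℝ} (hc : 0 < c) {n : ℕ} (hL : 0 ≤ Real.logb (1 / p) n) :
    (Nat.clog 2 (numRounds c n p) : ℝ) ≤
      (1 + (Real.log (20 * c + 41) + 1) / Real.log 2) *
        max 1 (Real.log (Real.logb (1 / p) n)) := by
  set K := numRounds c n p with hKdef
  set L := Real.logb (1 / p) n with hLdef
  set m := max 1 (Real.log L) with hm
  have hm1 : 1 ≤ m := le_max_left _ _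
  have hl2 : 0 < Real.log 2 := Real.log_pos (by norm_num)
  have hLm : L ≤ Real.exp m := by
    rcases hL.eq_or_lt with h | h
    · rw [← h]; positivity
    · exact (Real.log_le_iff_le_exp h).1 (le_max_right _ _)
  have hm0 : 1 ≤ Real.exp m := Real.one_le_exp (by linarith)
  -- `41 = 20 + 1 + 20`: from `20 * (c + 1)`, from rounding up, and from the 20 extra rounds.
  have hK : (K : ℝ) ≤ (20 * c + 41) * Real.exp m := by
    have h1 := (Nat.ceil_lt_add_one (show 0 ≤ 20 * (c + 1) * L by positivity)).le
    have h2 : (K : ℝ) = (⌈20 * (c + 1) * L⌉₊ : ℝ) + 20 := by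
      rw [hKdef, numRounds]; push_cast; rfl
    have h3 : 20 * (c + 1) * L ≤ 20 * (c + 1) * Real.exp m := by gcongr
    linarith
  have hK20 : 20 ≤ K := by rw [hKdef, numRounds]; lia
  have hKpos : (0 : ℝ) < K := by exact_mod_cast (by lia : 0 < K)
  have hpow : (2 : ℝ) ^ (Nat.clog 2 K - 1) ≤ K := by
    exact_mod_cast (Nat.pow_pred_clog_lt_self (by norm_num) (by lia : 1 < K)).le
  have hclog : 1 ≤ Nat.clog 2 K := Nat.clog_pos (by norm_num) (by lia)
  have hlog : ((Nat.clog 2 K : ℝ) - 1) * Real.log 2 ≤ Real.log (20 * c + 41) + m := by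
    calc _ = Real.log ((2 : ℝ) ^ (Nat.clog 2 K - 1)) := by
          rw [Real.log_pow, Nat.cast_sub hclog, Nat.cast_one]
      _ ≤ Real.log ((20 * c + 41) * Real.exp m) :=
          Real.log_le_log (by positivity) (hpow.trans hK)
      _ = _ := by rw [Real.log_mul (by positivity) (Real.exp_ne_zero _), Real.log_exp]
  have hlogc : 0 ≤ Real.log (20 * c + 41) := Real.log_nonneg (by linarith)
  have h4 : (Nat.clog 2 K : ℝ) - 1 ≤ (Real.log (20 * c + 41) + m) / Real.log 2 :=
    (le_div_iff₀ hl2).2 hlog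
  have h5 : (Real.log (20 * c + 41) + m) / Real.log 2 ≤
      (Real.log (20 * c + 41) + 1) / Real.log 2 * m := by
    rw [div_mul_eq_mul_div]
    gcongr
    nlinarith
  nlinarith

lemma numProbesBound_le {c p : ℝ} (hc : 0 < c) {n d : ℕ} (hd : 2 ≤ d)
    (hL : 0 ≤ Real.logb (1 / p) n) :
    (numProbesBound c n d p : ℝ) ≤ probeBound (probeConstant c) n d p := by
  set τ := Nat.clog 2 (numRounds c n p) with hτ
  have hτ1 : 1 ≤ τ := Nat.clog_pos (by norm_num) (by rw [numRounds]; lia)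
  have hd1 : (1 : ℝ) ≤ d := by exact_mod_cast (by lia : 1 ≤ d)
  -- `71 = 1 + 2 * 35`, by `2 ≤ d`, `d + 1 ≤ d ^ 2` and `30τ + 5 ≤ 35τ`.
  have h1 : numProbesBound c n d p ≤ d ^ (71 * τ) := by
    rw [numProbesBound, ← hτ]
    calc 2 ^ τ * (d + 1) ^ (30 * τ + 5)
      _ ≤ d ^ τ * (d ^ 2) ^ (35 * τ) := by
          refine Nat.mul_le_mul (Nat.pow_le_pow_left hd _) ?_
          refine (Nat.pow_le_pow_left (by nlinarith : d + 1 ≤ d ^ 2) _).trans ?_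
          exact Nat.pow_le_pow_right (by positivity) (by lia)
      _ = d ^ (71 * τ) := by rw [← pow_mul, ← pow_add]; congr 1; ring
  calc (numProbesBound c n d p : ℝ) ≤ (d : ℝ) ^ (71 * τ) := by exact_mod_cast h1
    _ = (d : ℝ) ^ ((71 * τ : ℕ) : ℝ) := (Real.rpow_natCast _ _).symm
    _ ≤ _ := by
        refine Real.rpow_le_rpow_of_exponent_le hd1 ?_
        rw [probeConstant]
        push_cast
        have := clog_numRounds_le hc hL
        rw [← hτ] at this
        linarith

end numerics

/-! ### Assembling the theorem -/

section main

variable {Ω : Type*} [MeasurableSpace Ω] [StandardBorelSpace Ω] [Nonempty Ω]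

lemma LLLInstance.HasParams.measure_not_isSolution_le_rpow {n : ℕ} {I : LLLInstance Ω n}
    {κ d : ℕ} {p c : ℝ} (hI : I.HasParams κ d p) (hn : 1 ≤ n) (hd : 2 ^ 132 ≤ d) (hp : 0 < p)
    (hpd : p ≤ (d : ℝ) ^ (-10 : ℝ)) (hp1 : 5 * p ≤ 1) :
    bitMeasure n {r | ¬ I.IsSolution fun v =>
        (resamplingAlgorithm Ω (Nat.clog 2 (numRounds c n p)) (numRounds c n p)
          (numProbesBound c n d p) (I.id v)).run (I.volumeOracle r)} ≤
      ENNReal.ofReal ((n : ℝ) ^ (-c)) := by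
  have : Nonempty (Fin n) := ⟨⟨0, hn⟩⟩
  obtain ⟨hy, hy20, hay, hsmall⟩ := exists_twentieth_root hd hp hpd
  have hbound := root_pow_numRounds_le (c := c) hn hp hp1
  set y := p ^ (1 / 20 : ℝ)
  set K := numRounds c n p with hK
  set τ := Nat.clog 2 K with hτ
  have hKτ : K ≤ 2 ^ τ := Nat.le_pow_clog (by norm_num) K
  have hτ1 : 1 ≤ τ := Nat.clog_pos (by norm_num) (by rw [hK, numRounds]; lia)
  have ha : (0 : ℝ) < (d : ℝ) + 1 := by positivity
  have hα := weight_le_root ha.le hy hay hsmall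
  have hβ := cluster_weight_le ha.le hy hay hsmall hτ1 hKτ
  have hF4 := one_add_inv_pow_le_four (Nat.succ_pos d)
  have hy1 : y ≤ 1 := by linarith
  have ha8 : 1 / (8 * ((d : ℝ) + 1) ^ 2) ≤ 1 := by
    rw [div_le_one (by positivity)]
    nlinarith
  set α := 64 * ((d : ℝ) + 1) ^ 4 * y ^ 20 with hαdef
  have hα0 : 0 ≤ α := by positivity
  have four : (4 : ENNReal) = ENNReal.ofReal 4 := by simp
  -- With these choices `A * q₀ ^ 2` is exactly `p`.
  refine (hI.measure_not_isSolution_le hKτ ?_ (F := 4)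
    (q₀ := ENNReal.ofReal (1 / (8 * ((d : ℝ) + 1) ^ 2))) (A := ENNReal.ofReal α)
    (by norm_num) ?_ ?_ ?_ ?_).trans ?_
  · rw [numProbesBound, ← hK, ← hτ]
    calc K * (d + 1) ^ (20 * τ + 1) * (d + 1) ^ (10 * τ + 4)
        ≤ 2 ^ τ * (d + 1) ^ (20 * τ + 1) * (d + 1) ^ (10 * τ + 4) := by gcongr
      _ = 2 ^ τ * (d + 1) ^ (30 * τ + 5) := by ring
  · rw [four, ← ENNReal.ofReal_mul (by positivity), ← ENNReal.ofReal_one,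
      ← ENNReal.ofReal_add (by positivity) zero_le_one, ← ENNReal.ofReal_pow (by positivity)]
    refine ENNReal.ofReal_le_ofReal ?_
    simpa using hF4
  · exact ENNReal.ofReal_le_one.2 ha8
  · exact ENNReal.ofReal_le_one.2 (hα.trans hy1)
  · rw [← ENNReal.ofReal_pow (by positivity), ← ENNReal.ofReal_mul hα0]
    refine ENNReal.ofReal_le_ofReal (le_of_eq ?_)
    rw [hαdef, hy20]
    field_simp
    norm_num
  · clear_value α
    have hcast : (K : ENNReal) * ((d : ENNReal) + 1) ^ (20 * τ + 3) *
        (ENNReal.ofReal α ^ (4 * τ) * 4) = ENNReal.ofReal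
          (K * ((d : ℝ) + 1) ^ (20 * τ + 3) * (α ^ (4 * τ) * 4)) := by
      rw [ENNReal.ofReal_mul (by positivity), ENNReal.ofReal_mul (by positivity),
        ENNReal.ofReal_mul (by positivity), ENNReal.ofReal_pow ha.le,
        ENNReal.ofReal_pow hα0,
        ENNReal.ofReal_add (by positivity) zero_le_one, ENNReal.ofReal_natCast,
        ENNReal.ofReal_natCast, ENNReal.ofReal_one, ← four]
    rw [hcast]
    calc _ ≤ (n : ENNReal) * (ENNReal.ofReal y ^ K * ENNReal.ofReal 4 +
          ENNReal.ofReal y ^ K) := by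
          rw [four]
          gcongr
      _ = ENNReal.ofReal (5 * n * y ^ K) := by
          rw [← ENNReal.ofReal_pow hy.le, ← ENNReal.ofReal_mul (by positivity),
            ← ENNReal.ofReal_add (by positivity) (by positivity), ← ENNReal.ofReal_natCast n,
            ← ENNReal.ofReal_mul (by positivity)]
          congr 1
          ring
      _ ≤ _ := ENNReal.ofReal_le_ofReal hbound

lemma LLLInstance.HasParams.resamplingAlgorithm_solves {n : ℕ} {I : LLLInstance Ω n}
    {κ d : ℕ} {p c : ℝ} (hI : I.HasParams κ d p) (hc : 0 < c) (hd : 2 ^ 132 ≤ d) (hp : 0 < p)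
    (hpd : p ≤ (d : ℝ) ^ (-10 : ℝ)) :
    (resamplingAlgorithm Ω (Nat.clog 2 (numRounds c n p)) (numRounds c n p)
      (numProbesBound c n d p)).Solves I (probeBound (probeConstant c) n d p)
        ((n : ℝ) ^ (-c)) := by
  -- For `n = 0` there is nothing to violate, and the failure set is empty.
  rcases Nat.eq_zero_or_pos n with rfl | hn
  · refine ⟨fun _ v => v.elim0, ?_⟩
    refine le_of_eq_of_le ((congrArg _ ?_).trans measure_empty) zero_le
    exact Set.eq_empty_of_forall_notMem fun r hr => hr ⟨fun _ => Classical.arbitrary Ω,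
      fun v => v.elim0, fun v => v.elim0⟩
  have hp1 : 5 * p ≤ 1 := by
    obtain ⟨hy, hy20, -, hsmall⟩ := exists_twentieth_root hd hp hpd
    set y := p ^ (1 / 20 : ℝ)
    have h19 : y ^ 19 ≤ 1 := pow_le_one₀ hy.le (by linarith)
    rw [← hy20]
    nlinarith
  refine ⟨fun r v => ⟨?_, ?_⟩, hI.measure_not_isSolution_le_rpow hn hd hp hpd hp1⟩
  · refine le_trans ?_ (numProbesBound_le hc (le_trans (by norm_num) hd)
      (logb_one_div_nonneg hn hp hp1))
    exact_mod_cast Oracle.numProbes_explore_le _ _ _ _ _ _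
  · refine Oracle.connected_explore _ _ _ _ _ _ _ rfl ?_
    intro u i hi
    simp [Oracle.adj] at hi

end main

theorem theorem3 (ε c : ℝ) (hε : 0 < ε) (hc : 0 < c) (κ : ℕ) :
    ∃ (C : ℝ) (d₀ : ℕ), ∀ (Ω : Type*) [MeasurableSpace Ω] [StandardBorelSpace Ω] [Nonempty Ω]
      (n d : ℕ) (p : ℝ), d₀ ≤ d → 0 < p → p ≤ (d : ℝ) ^ (-(10 + ε)) →
      (∃ A : LCAAlgorithm Ω, ∀ I : LLLInstance Ω n, I.HasParams κ d p →
        A.Solves I (probeBound C n d p) ((n : ℝ) ^ (-c))) ∧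
      (∃ A : VolumeAlgorithm Ω, ∀ I : LLLInstance Ω n, I.HasParams κ d p →
        A.Solves I (probeBound C n d p) ((n : ℝ) ^ (-c))) := by
  refine ⟨probeConstant c, 2 ^ 132, fun Ω _ _ _ n d p hd hp hpε => ?_⟩
  have hpd : p ≤ (d : ℝ) ^ (-10 : ℝ) := by
    refine hpε.trans (Real.rpow_le_rpow_of_exponent_le ?_ (by linarith))
    exact_mod_cast le_trans (by norm_num) hd
  exact ⟨⟨_, fun I hI => (hI.resamplingAlgorithm_solves hc hd hp hpd).toLCA⟩,
    ⟨_, fun I hI => hI.resamplingAlgorithm_solves hc hd hp hpd⟩⟩
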